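/- Let $q$ be a prime power and let $1\le d\le q+1$ be an integer; assume that $q$ is odd, or that $q$ is even and $d$ is odd. Then there exists a quantum MDS code $[\![q^2+1,\,q^2+3-2d,\,d]\!]_q$, that is, a subspace of $(\mathbb{C}^q)^{\otimes (q^2+1)}$ of dimension $q^{\,q^2+3-2d}$ whose minimum distance is exactly $d$ (every error acting on fewer than $d$ of the qudits is detectable, and some error acting on at most $d$ qudits is not), so that the quantum Singleton bound $k+2d\le n+2$ holds with equality. Moreover, such a code is obtained as follows. Put $n=q^2+1$. For a linear code $C\subseteq\mathbb{F}_{q^2}^n$ let $C^*=\{v\in\mathbb{F}_{q^2}^n : \sum_i c_i^q v_i=0 \text{ for all } c\in C\}$ be its Hermitian dual and let $P(C)=\langle (c_i^q c_i')_{i=1}^n : c,c'\in C\rangle_{\mathbb{F}_{q^2}}^{\perp}\cap\mathbb{F}_q^n$ be its puncture code. There are a linear code $C\subseteq\mathbb{F}_{q^2}^n$ such that $C^*$ is a cyclic or constacyclic MDS code with parameters $[q^2+1,\,q^2+2-d,\,d]_{q^2}$, a word $x\in P(C)$ of Hamming weight $q^2+1$, and $y\in\mathbb{F}_{q^2}^n$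 with $y_i^{q+1}=x_i$ for all $i$, such that the code $D=\{(y_ic_i)_{i=1}^n : c\in C\}$ is contained in $D^*$ and a stabilizer code belonging to $D$ is a quantum MDS code $[\![q^2+1,q^2+3-2d,d]\!]_q$. Here, for a fixed nontrivial additive character $\chi$ of $\mathbb{F}_q$ and a fixed $\mathbb{F}_q$-basis of $\mathbb{F}_{q^2}$ (both arbitrary), a stabilizer code belonging to $D$ is a nonzero joint eigenspace of the operators $X(a)Z(b)$, where $X(a)|z\rangle=|z+a\rangle$, $Z(b)|z\rangle=\chi(\sum_i b_iz_i)|z\rangle$ for $z\in\mathbb{F}_q^n$, and $(a_i,b_i)$ are the coordinates of $c_i$ in that basis, for $c\in D$. -/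

import Mathlib

/-! ### Classical linear codes -/

section Classical

variable {ι : Type*} [Fintype ι] {K F : Type*} [Field K] [Field F] [Algebra K F]

/-- `C` is a linear code `[n, k, d]` (with `n` the number of coordinates): it has dimension `k`
and the least Hamming weight of a nonzero codeword is exactly `d`. -/
def IsLinearCode [DecidableEq F] (C : Submodule F (ι → F)) (k d : ℕ) : Prop :=
  Module.finrank F C = k ∧ IsLeast {w : ℕ | ∃ c ∈ C, c ≠ 0 ∧ hammingNorm c = w} d

/-- `C` is an MDS code `[n, k, d]`, that is, a linear code with `k + d = n + 1`. -/
def IsMDSCode [DecidableEq F] (C : Submodule F (ι → F)) (k d : ℕ) : Prop :=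
  IsLinearCode C k d ∧ k + d = Fintype.card ι + 1

/-- The constacyclic shift `(c₀, …, cₙ₋₁) ↦ (γ cₙ₋₁, c₀, …, cₙ₋₂)`.
(Subtraction in `Fin n` is modulo `n`, so `0 - 1` is the last index.) -/
def constaShift {n : ℕ} [NeZero n] (γ : F) (c : Fin n → F) : Fin n → F :=
  fun i => if i = 0 then γ * c (i - 1) else c (i - 1)

/-- `C` is constacyclic for some nonzero shift constant `γ`; it is cyclic when `γ = 1`. -/
def IsConstacyclic {n : ℕ} [NeZero n] (C : Submodule F (Fin n → F)) : Prop :=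
  ∃ γ : F, γ ≠ 0 ∧ ∀ c ∈ C, constaShift γ c ∈ C

/-- The Hermitian dual `{v | ∀ c ∈ C, ∑ cᵢ^q vᵢ = 0}` of a code over the field with `q²`
elements. -/
def hermitianDual (q : ℕ) (C : Submodule F (ι → F)) : Submodule F (ι → F) where
  carrier := {v | ∀ c ∈ C, ∑ i, c i ^ q * v i = 0}
  zero_mem' := by intro c _; simp
  add_mem' := by
    intro v w hv hw c hc
    simp only [Pi.add_apply, mul_add, Finset.sum_add_distrib, hv c hc, hw c hc, add_zero]
  smul_mem' := by
    intro a v hv c hc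
    have h : ∀ i, c i ^ q * (a • v) i = a * (c i ^ q * v i) := by
      intro i; simp only [Pi.smul_apply, smul_eq_mul]; ring
    simp only [h, ← Finset.mul_sum, hv c hc, mul_zero]

/-- The puncture code `⟨(cᵢ^q c'ᵢ)ᵢ : c, c' ∈ C⟩^⊥ ∩ Kⁿ`, where the span is over `F`, the dual is
with respect to the standard bilinear form, and `K` is the subfield with `q` elements. -/
def punctureCode (K : Type*) [Field K] [Algebra K F] (q : ℕ) (C : Submodule F (ι → F)) :
    Submodule K (ι → K) where
  carrier := {x | ∀ s ∈ Submodule.span F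
      {s : ι → F | ∃ c ∈ C, ∃ c' ∈ C, s = fun i => c i ^ q * c' i},
    ∑ i, s i * algebraMap K F (x i) = 0}
  zero_mem' := by intro s _; simp
  add_mem' := by
    intro x y hx hy s hs
    simp only [Pi.add_apply, map_add, mul_add, Finset.sum_add_distrib, hx s hs, hy s hs, add_zero]
  smul_mem' := by
    intro a x hx s hs
    have h : ∀ i, s i * algebraMap K F ((a • x) i)
        = algebraMap K F a * (s i * algebraMap K F (x i)) := by
      intro i; simp only [Pi.smul_apply, smul_eq_mul, map_mul]; ring
    simp only [h, ← Finset.mul_sum, hx s hs, mul_zero]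

/-- The code `{(yᵢ cᵢ)ᵢ : c ∈ C}`. -/
def rescale (y : ι → F) (C : Submodule F (ι → F)) : Submodule F (ι → F) :=
  C.map (LinearMap.pi fun i => y i • LinearMap.proj i)

end Classical

/-! ### Quantum codes

The state space of the qudits indexed by `ι`, each with orthonormal basis `|a⟩`, `a ∈ A`, is
`(ℂ^A)^{⊗ι}`; its product basis is indexed by `ι → A`, so it is the space `(ι → A) → ℂ` with the
Hermitian form `⟨u, v⟩ = ∑ₓ conj (u x) * v x = star u ⬝ᵥ v`. -/

section Quantum

variable {ι : Type*} [Fintype ι] [DecidableEq ι] {A : Type*} [Fintype A]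

/-- The operator `E` acts only on the qudits in `S`: it is `M ⊗ 1` for an operator `M` on the
qudits in `S`. -/
def ActsOn (S : Finset ι) (E : Matrix (ι → A) (ι → A) ℂ) : Prop :=
  ∃ M : Matrix (S → A) (S → A) ℂ, ∀ x y : ι → A,
    ((∀ i, i ∉ S → x i = y i) → E x y = M (fun i => x i) (fun i => y i)) ∧
    (¬ (∀ i, i ∉ S → x i = y i) → E x y = 0)

/-- The code `Q` detects every error on fewer than `d` qudits (Knill–Laflamme condition
`P E P = c_E P`, with `P` the projection onto `Q`). -/
def HasDistanceAtLeast (Q : Submodule ℂ ((ι → A) → ℂ)) (d : ℕ) : Prop :=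
  ∀ S : Finset ι, S.card < d → ∀ E : Matrix (ι → A) (ι → A) ℂ, ActsOn S E →
    ∃ c : ℂ, ∀ u ∈ Q, ∀ v ∈ Q, star u ⬝ᵥ E.mulVec v = c * (star u ⬝ᵥ v)

/-- `Q` is a quantum code `[[n, k, d]]_q` with `n` the number of qudits, `q` the size of `A`:
its dimension is `q ^ k` and its minimum distance is exactly `d`.  (Meant for `k ≥ 1`; for
one-dimensional codes the minimum distance is defined by a separate convention.) -/
def IsQuantumCode (Q : Submodule ℂ ((ι → A) → ℂ)) (k d : ℕ) : Prop :=
  Module.finrank ℂ Q = Fintype.card A ^ k ∧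
    HasDistanceAtLeast Q d ∧ ¬ HasDistanceAtLeast Q (d + 1)

/-- `Q` is a quantum MDS code `[[n, k, d]]_q`: equality holds in the quantum Singleton bound
`k + 2 d ≤ n + 2`. -/
def IsQuantumMDSCode (Q : Submodule ℂ ((ι → A) → ℂ)) (k d : ℕ) : Prop :=
  IsQuantumCode Q k d ∧ k + 2 * d = Fintype.card ι + 2

end Quantum

/-! ### Stabilizer codes -/

section Stabilizer

variable {ι : Type*} [Fintype ι] {K F : Type*} [Field K] [Field F] [Algebra K F]

/-- The generalized Pauli operator `X(a) Z(b)`, where `X(a)|x⟩ = |x + a⟩` and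
`Z(b)|x⟩ = χ(b · x)|x⟩` for an additive character `χ` of `K`. -/
def pauli (χ : AddChar K ℂ) (a b : ι → K) (v : (ι → K) → ℂ) : (ι → K) → ℂ :=
  fun x => χ (b ⬝ᵥ (x - a)) * v (x - a)

/-- `Q` is a stabilizer code belonging to the classical code `D` over the quadratic extension `F`
of `K`: codewords `c ∈ D` are read as Pauli operators `X(a) Z(b)` by `(aᵢ, bᵢ) = e (cᵢ)`, where `e`
gives the coordinates in a `K`-basis of `F`, and `Q` is a nonzero joint eigenspace of all of them.
Here `θ c` is the eigenvalue of the operator belonging to `c`; equivalently, `Q` is the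
fixed space of the operators `(θ c)⁻¹ X(a) Z(b)`. -/
def IsStabilizerCodeOf (χ : AddChar K ℂ) (e : F ≃ₗ[K] K × K) (D : Submodule F (ι → F))
    (Q : Submodule ℂ ((ι → K) → ℂ)) : Prop :=
  Q ≠ ⊥ ∧ ∃ θ : (ι → F) → ℂ, ∀ v : (ι → K) → ℂ,
    v ∈ Q ↔ ∀ c ∈ D, pauli χ (fun i => (e (c i)).1) (fun i => (e (c i)).2) v = θ c • v

end Stabilizer

/-! Write `E` for the quadratic extension of `F`, so that `K`, `F`, `E` have `q`, `q ^ 2`, `q ^ 4`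
elements. The powers `1, η, …, η ^ (q ^ 2)` of a generator `η` of the unit group of `E` represent
the points of the projective line over `F`. For `d ≥ 2`, `C` consists of the values there of binary
forms of degree `m = d - 2`. Products of linear forms separate any `m + 1` points, so the Hermitian
dual is MDS. It is constacyclic because `η ^ (q ^ 2 + 1)` is the norm of `η`, a scalar in `F`.

A full-weight puncture word is a nowhere vanishing `K`-valued `h` with `∑ h f ^ q g = 0` for all
forms `f`, `g` of degree `m`. Forms of degree `q ^ 2 - 1` sum to zero over the points
(`sum_points_eq_zero`), so `h = 1` serves `m = q - 1`. For odd `q` an explicit `h` built from norms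
and a trace serves `m = q - 2` (`exists_isMultiplier_of_odd`). Norm factors lower `m` by even
amounts (`IsMultiplier.norm_pow_mul`), which accounts for the parity condition.

Taking `(q + 1)`-st roots of `h` makes the rescaled code `D` Hermitian self-orthogonal. By
`mem_hermitianDual_iff_sympForm` its Pauli operators commute, so they have a joint eigenspace. Its
dimension is the trace of its projection, and its distance is read off from the weights in the
Hermitian dual of `D` and in `D`. -/

section ExtendZero

variable {ι K : Type*} [DecidableEq ι] [Zero K]

/-- Extension of a vector on the coordinates in `S` by zero. -/
def extendZero (S : Finset ι) (a : S → K) : ι → K := fun i => if h : i ∈ S then a ⟨i, h⟩ else 0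

lemma extendZero_of_notMem {S : Finset ι} (a : S → K) {i : ι} (h : i ∉ S) :
    extendZero S a i = 0 := dif_neg h

lemma extendZero_coe {S : Finset ι} (a : S → K) (i : S) : extendZero S a i = a i := by
  simp [extendZero]

end ExtendZero

/-! ### Pauli operators as a basis of local errors -/

section PauliOperators

variable {ι : Type*} [Fintype ι] {K : Type*} [Field K]

lemma pauli_pauli (χ : AddChar K ℂ) (a b a' b' : ι → K) (v : (ι → K) → ℂ) :
    pauli χ a b (pauli χ a' b' v) = χ (b ⬝ᵥ a') • pauli χ (a + a') (b + b') v := by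
  funext x
  have h : b ⬝ᵥ (x - a) + b' ⬝ᵥ (x - a - a') = b ⬝ᵥ a' + (b + b') ⬝ᵥ (x - (a + a')) := by
    simp only [add_dotProduct, dotProduct_sub, dotProduct_add]; ring
  simp only [pauli, Pi.smul_apply, smul_eq_mul]
  rw [← mul_assoc, ← mul_assoc, ← AddChar.map_add_eq_mul, ← AddChar.map_add_eq_mul, h, sub_sub]

/-- The operator `X(a) Z(b)` as a linear map. -/
def pauliEnd (χ : AddChar K ℂ) (a b : ι → K) : Module.End ℂ ((ι → K) → ℂ) where
  toFun := pauli χ a b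
  map_add' u v := by funext x; simp [pauli, mul_add]
  map_smul' r v := by funext x; simp [pauli]; ring

@[simp] lemma pauliEnd_apply (χ : AddChar K ℂ) (a b : ι → K) (v : (ι → K) → ℂ) :
    pauliEnd χ a b v = pauli χ a b v := rfl

variable [DecidableEq ι]

lemma extendZero_dotProduct {S : Finset ι} (b : S → K) (y : ι → K) :
    extendZero S b ⬝ᵥ y = b ⬝ᵥ fun i : S => y i := by
  simp only [dotProduct]
  rw [← Finset.sum_subset (Finset.subset_univ S), ← Finset.sum_coe_sort S]
  · simp [extendZero_coe]
  · intro i _ hi; simp [extendZero_of_notMem b hi]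

/-- The matrix of `X(a) Z(b)`. -/
def pauliMatrix [DecidableEq K] (χ : AddChar K ℂ) (a b : ι → K) : Matrix (ι → K) (ι → K) ℂ :=
  fun x y => if x = y + a then χ (b ⬝ᵥ y) else 0

lemma actsOn_pauliMatrix [DecidableEq K] (χ : AddChar K ℂ) {a b : ι → K} {S : Finset ι}
    (ha : ∀ i, i ∉ S → a i = 0) (hb : ∀ i, i ∉ S → b i = 0) : ActsOn S (pauliMatrix χ a b) := by
  have hbS : ∀ y, b ⬝ᵥ y = (fun i : S => b i) ⬝ᵥ fun i : S => y i := by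
    intro y
    rw [← extendZero_dotProduct]
    congr 1; funext i
    by_cases hi : i ∈ S <;> simp [extendZero, hi, hb]
  refine ⟨pauliMatrix χ (fun i => a i) (fun i => b i), fun x y => ⟨fun h => ?_, fun h => ?_⟩⟩
  · have : x = y + a ↔ (fun i : S => x i) = (fun i : S => y i) + fun i : S => a i := by
      simp only [funext_iff, Pi.add_apply]
      refine ⟨fun h i => h i, fun h' i => ?_⟩
      by_cases hi : i ∈ S
      · exact h' ⟨i, hi⟩
      · rw [h i hi, ha i hi, add_zero]
    simp only [pauliMatrix, this, hbS y]
  · rw [pauliMatrix, if_neg]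
    rintro rfl
    exact h fun i hi => by simp [ha i hi]

variable [Fintype K]

lemma sum_addChar_dotProduct [DecidableEq K] {χ : AddChar K ℂ} (hχ : χ ≠ 1) (t : ι → K) :
    ∑ b : ι → K, χ (b ⬝ᵥ t) = if t = 0 then (Fintype.card (ι → K) : ℂ) else 0 := by
  classical
  split_ifs with ht
  · simp [ht]
  · let ψ : AddChar (ι → K) ℂ :=
      { toFun := fun b => χ (b ⬝ᵥ t)
        map_zero_eq_one' := by simp
        map_add_eq_mul' := fun a b => by simp [add_dotProduct, AddChar.map_add_eq_mul] }
    obtain ⟨i, hi⟩ : ∃ i, t i ≠ 0 := by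
      by_contra! h; exact ht (funext h)
    obtain ⟨r, hr⟩ : ∃ r, χ r ≠ 1 := by
      by_contra! h; exact hχ (by ext r; simp [h])
    have hψ : ψ ≠ 0 := by
      intro h
      have h1 : χ (Pi.single i (r / t i) ⬝ᵥ t) = 1 := DFunLike.congr_fun h (Pi.single i (r / t i))
      rw [single_dotProduct, div_mul_cancel₀ _ hi] at h1
      exact hr h1
    exact AddChar.sum_eq_zero_iff_ne_zero.2 hψ

lemma star_pauli_dotProduct_pauli (χ : AddChar K ℂ) (a b : ι → K) (u v : (ι → K) → ℂ) :
    star (pauli χ a b u) ⬝ᵥ pauli χ a b v = star u ⬝ᵥ v := by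
  simp only [dotProduct, pauli, Pi.star_apply]
  refine Fintype.sum_equiv (Equiv.subRight a) _ _ fun x => ?_
  have h : star (χ (b ⬝ᵥ (x - a))) * χ (b ⬝ᵥ (x - a)) = 1 := by
    have := AddChar.norm_apply χ (b ⬝ᵥ (x - a))
    rw [Complex.star_def, Complex.conj_mul', this]; simp
  simp only [Equiv.subRight_apply, star_mul, dotProduct] at h ⊢
  linear_combination (star (u (x - a)) * v (x - a)) * h

/-- A nonzero shift has empty diagonal; without a shift the trace is a sum over a nontrivial
character. -/
lemma trace_pauliEnd {χ : AddChar K ℂ} (hχ : χ ≠ 1) (a b : ι → K) (h : a ≠ 0 ∨ b ≠ 0) :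
    LinearMap.trace ℂ _ (pauliEnd χ a b) = 0 := by
  classical
  rw [LinearMap.trace_eq_matrix_trace ℂ (Pi.basisFun ℂ (ι → K))]
  simp only [Matrix.trace, Matrix.diag_apply, LinearMap.toMatrix_apply, Pi.basisFun_apply,
    Pi.basisFun_repr, pauliEnd_apply, pauli]
  by_cases ha : a = 0
  · have hb : b ≠ 0 := by tauto
    have := sum_addChar_dotProduct hχ b
    rw [if_neg hb] at this
    simpa [ha, dotProduct_comm b] using this
  · refine Finset.sum_eq_zero fun x _ => ?_
    rw [Pi.single_eq_of_ne, mul_zero]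
    simpa using ha

/-- Every operator acting on the qudits in `S` is a linear combination of Pauli operators acting on
these qudits. -/
lemma ActsOn.exists_pauli_expansion {χ : AddChar K ℂ} (hχ : χ ≠ 1) {S : Finset ι}
    {E : Matrix (ι → K) (ι → K) ℂ} (hE : ActsOn S E) :
    ∃ m : (S → K) → (S → K) → ℂ, ∀ v, E.mulVec v =
      ∑ a, ∑ b, m a b • pauli χ (extendZero S a) (extendZero S b) v := by
  classical
  obtain ⟨M, hM⟩ := hE
  set N : ℂ := (Fintype.card (S → K) : ℂ) with hN
  have hN0 : N ≠ 0 := by simp [hN]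
  -- Fourier inversion: for each shift `a`, the function `s ↦ M (s + a) s` is expanded in the
  -- characters `χ (b ⬝ᵥ ·)`.
  refine ⟨fun a b => N⁻¹ * ∑ s, χ (b ⬝ᵥ (-s)) * M (s + a) s, fun v => funext fun x => ?_⟩
  have hl : E.mulVec v x = ∑ a : S → K,
      M (fun i => x i) ((fun i : S => x i) - a) * v (x - extendZero S a) := by
    rw [Matrix.mulVec, dotProduct]
    symm
    refine Fintype.sum_of_injective (fun a : S → K => x - extendZero S a) ?_ _ _ ?_ ?_
    · intro a a' h
      funext i
      have := congrFun h i
      simpa [extendZero_coe] using this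
    · intro y hy
      rw [(hM x y).2, zero_mul]
      intro h
      refine hy ⟨fun i => x i - y i, funext fun i => ?_⟩
      by_cases hi : i ∈ S
      · simp [extendZero, hi]
      · simp [extendZero, hi, h i hi]
    · intro a
      rw [(hM x (x - extendZero S a)).1]
      · congr 2; funext i; simp [extendZero_coe]
      · intro i hi; simp [extendZero_of_notMem a hi]
  rw [hl, Finset.sum_apply]
  refine Finset.sum_congr rfl fun a _ => ?_
  set y : S → K := (fun i : S => x i) - a with hy
  have hy' : (fun i : S => (x - extendZero S a) i) = y := by
    funext i; simp [hy, extendZero_coe]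
  have hx : (fun i : S => x i) = y + a := by simp [hy]
  simp only [Finset.sum_apply, Pi.smul_apply, pauli, smul_eq_mul, extendZero_dotProduct]
  rw [hy', hx]
  have key : ∑ b : S → K, (N⁻¹ * ∑ s, χ (b ⬝ᵥ (-s)) * M (s + a) s) * χ (b ⬝ᵥ y) = M (y + a) y := by
    calc _ = N⁻¹ * ∑ s, M (s + a) s * ∑ b : S → K, χ (b ⬝ᵥ (y - s)) := by
          simp only [Finset.mul_sum, Finset.sum_mul]
          rw [Finset.sum_comm]
          refine Finset.sum_congr rfl fun s _ => Finset.sum_congr rfl fun b _ => ?_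
          rw [sub_eq_add_neg, dotProduct_add, AddChar.map_add_eq_mul]; ring
      _ = M (y + a) y := by
          simp only [sum_addChar_dotProduct hχ, sub_eq_zero, mul_ite, mul_zero]
          rw [Finset.sum_ite_eq]
          simp only [Finset.mem_univ, if_true]
          rw [← hN]; field_simp
  rw [← key, Finset.sum_mul]
  exact Finset.sum_congr rfl fun b _ => by ring

lemma pauliMatrix_mulVec [DecidableEq K] (χ : AddChar K ℂ) (a b : ι → K) (v : (ι → K) → ℂ) :
    (pauliMatrix χ a b).mulVec v = pauli χ a b v := by
  funext x
  rw [Matrix.mulVec, dotProduct, Finset.sum_eq_single (x - a)]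
  · simp [pauliMatrix, pauli]
  · intro y _ hy
    rw [pauliMatrix, if_neg, zero_mul]
    rintro rfl; simp at hy
  · simp

end PauliOperators

/-- A commuting family of endomorphisms of a nonzero finite-dimensional complex space has a common
eigenvector. -/
lemma exists_common_eigenvector {V I : Type*} [AddCommGroup V] [Module ℂ V]
    [FiniteDimensional ℂ V] [Nontrivial V] (T : I → Module.End ℂ V)
    (hT : ∀ i j v, T i (T j v) = T j (T i v)) :
    ∃ v : V, v ≠ 0 ∧ ∀ i, ∃ μ : ℂ, T i v = μ • v := by
  -- On a minimal nonzero invariant subspace every `T i` is scalar: its eigenspaces there are again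
  -- invariant, since the family commutes.
  obtain ⟨p, ⟨hp, hpT⟩, hmin⟩ := wellFounded_lt.has_min
    {p : Submodule ℂ V | p ≠ ⊥ ∧ ∀ i, ∀ v ∈ p, T i v ∈ p} ⟨⊤, by simp, by simp⟩
  obtain ⟨v, hv, hv0⟩ := p.exists_mem_ne_zero_of_ne_bot hp
  refine ⟨v, hv0, fun i => ?_⟩
  have : Nontrivial p := ⟨⟨v, hv⟩, 0, by simpa [Subtype.ext_iff] using hv0⟩
  obtain ⟨μ, hμ⟩ := Module.End.exists_eigenvalue ((T i).restrict (hpT i))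
  obtain ⟨w, hw⟩ := hμ.exists_hasEigenvector
  have hwe : T i w = μ • (w : V) := congrArg Subtype.val hw.apply_eq_smul
  have hle : ¬ p ⊓ Module.End.eigenspace (T i) μ < p := by
    refine hmin _ ⟨?_, fun j u hu => ⟨hpT j u hu.1, ?_⟩⟩
    · rw [Submodule.ne_bot_iff]
      exact ⟨w, ⟨w.2, Module.End.mem_eigenspace_iff.2 hwe⟩, by simpa using hw.2⟩
    · refine Module.End.mem_eigenspace_iff.2 ?_
      rw [hT, Module.End.mem_eigenspace_iff.1 hu.2, map_smul]
  have heq : p ⊓ Module.End.eigenspace (T i) μ = p :=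
    eq_of_le_of_not_lt inf_le_left hle
  rw [← heq] at hv
  exact ⟨μ, Module.End.mem_eigenspace_iff.1 hv.2⟩

/-! ### Stabilizer codes: existence, dimension and distance -/

section StabilizerCodes

open scoped ComplexOrder

variable {ι : Type*} [Fintype ι] {K F : Type*} [Field K] [Field F] [Algebra K F]

/-- The Pauli operator belonging to a word over `F`. -/
def pauliOfWord (χ : AddChar K ℂ) (e : F ≃ₗ[K] K × K) (c : ι → F) :
    Module.End ℂ ((ι → K) → ℂ) :=
  pauliEnd χ (fun i => (e (c i)).1) (fun i => (e (c i)).2)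

/-- The symplectic form on words over `F`, in the coordinates given by `e`. -/
def sympForm (e : F ≃ₗ[K] K × K) (c c' : ι → F) : K :=
  ∑ i, ((e (c i)).2 * (e (c' i)).1 - (e (c' i)).2 * (e (c i)).1)

/-- The phase in the product of the Pauli operators belonging to two words. -/
def pauliPhase (e : F ≃ₗ[K] K × K) (c c' : ι → F) : K :=
  (fun i => (e (c i)).2) ⬝ᵥ fun i => (e (c' i)).1

lemma sympForm_eq (e : F ≃ₗ[K] K × K) (c c' : ι → F) :
    sympForm e c c' = pauliPhase e c c' - pauliPhase e c' c := by
  simp [sympForm, pauliPhase, dotProduct, Finset.sum_sub_distrib]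

lemma pauliOfWord_pauliOfWord (χ : AddChar K ℂ) (e : F ≃ₗ[K] K × K) (c c' : ι → F)
    (v : (ι → K) → ℂ) : pauliOfWord χ e c (pauliOfWord χ e c' v) =
      χ (pauliPhase e c c') • pauliOfWord χ e (c + c') v := by
  simp only [pauliOfWord, pauliEnd_apply, pauli_pauli, pauliPhase]
  congr 2 <;> (funext i; simp)

lemma pauliOfWord_comm (χ : AddChar K ℂ) (e : F ≃ₗ[K] K × K) (c c' : ι → F) (v : (ι → K) → ℂ) :
    pauliOfWord χ e c (pauliOfWord χ e c' v) =
      χ (sympForm e c c') • pauliOfWord χ e c' (pauliOfWord χ e c v) := by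
  rw [pauliOfWord_pauliOfWord, pauliOfWord_pauliOfWord, smul_smul, ← AddChar.map_add_eq_mul,
    sympForm_eq, sub_add_cancel, add_comm c]

lemma pauliOfWord_zero (χ : AddChar K ℂ) (e : F ≃ₗ[K] K × K) (v : (ι → K) → ℂ) :
    pauliOfWord χ e (0 : ι → F) v = v := by
  funext x
  have h : (x - fun _ : ι => (0 : K)) = x := sub_zero x
  simp [pauliOfWord, pauli, dotProduct, h]

lemma sympForm_smul_right (e : F ≃ₗ[K] K × K) (c c' : ι → F) (r : K) :
    sympForm e c (r • c') = r * sympForm e c c' := by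
  simp only [sympForm, Pi.smul_apply, map_smul, Prod.smul_fst, Prod.smul_snd, smul_eq_mul,
    Finset.mul_sum]
  exact Finset.sum_congr rfl fun i _ => by ring

lemma sympForm_neg (e : F ≃ₗ[K] K × K) (c c' : ι → F) : sympForm e c c' = -sympForm e c' c := by
  simp [sympForm_eq]

/-- The joint eigenspace, with eigenvalues `θ`, of the Pauli operators belonging to `D`. -/
def stabilizerSpace (χ : AddChar K ℂ) (e : F ≃ₗ[K] K × K) (D : Submodule F (ι → F))
    (θ : (ι → F) → ℂ) : Submodule ℂ ((ι → K) → ℂ) :=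
  ⨅ c ∈ D, Module.End.eigenspace (pauliOfWord χ e c) (θ c)

lemma mem_stabilizerSpace {χ : AddChar K ℂ} {e : F ≃ₗ[K] K × K} {D : Submodule F (ι → F)}
    {θ : (ι → F) → ℂ} {v : (ι → K) → ℂ} :
    v ∈ stabilizerSpace χ e D θ ↔ ∀ c ∈ D, pauliOfWord χ e c v = θ c • v := by
  simp [stabilizerSpace, Submodule.mem_iInf]

/-- `θ` multiplies on `D` like the Pauli operators belonging to words of `D`. -/
def IsEigenvalueSystem (χ : AddChar K ℂ) (e : F ≃ₗ[K] K × K) (D : Submodule F (ι → F))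
    (θ : (ι → F) → ℂ) : Prop :=
  ∀ c ∈ D, θ c ≠ 0 ∧ ∀ t ∈ D, θ c * θ t = χ (pauliPhase e c t) * θ (c + t)

/-- The projection onto the joint eigenspace. -/
noncomputable def stabilizerProj (χ : AddChar K ℂ) (e : F ≃ₗ[K] K × K) (D : Submodule F (ι → F))
    [Fintype D] (θ : (ι → F) → ℂ) : Module.End ℂ ((ι → K) → ℂ) :=
  (Fintype.card D : ℂ)⁻¹ • ∑ c : D, (θ c)⁻¹ • pauliOfWord χ e c

lemma stabilizerProj_isProj {χ : AddChar K ℂ} {e : F ≃ₗ[K] K × K} {D : Submodule F (ι → F)}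
    [Fintype D] {θ : (ι → F) → ℂ} (hθ : IsEigenvalueSystem χ e D θ) :
    LinearMap.IsProj (stabilizerSpace χ e D θ) (stabilizerProj χ e D θ) := by
  refine ⟨fun v => ?_, fun v hv => ?_⟩
  · rw [mem_stabilizerSpace]
    intro c hc
    simp only [stabilizerProj, LinearMap.smul_apply, LinearMap.sum_apply, map_smul, map_sum]
    rw [smul_comm (θ c)]
    congr 1
    rw [Finset.smul_sum]
    refine Fintype.sum_equiv (Equiv.addLeft (⟨c, hc⟩ : D)) _ _ fun c' => ?_
    have h1 := (hθ c hc).2 c' c'.2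
    have h2 := (hθ c' c'.2).1
    have h3 := (hθ _ (D.add_mem hc c'.2)).1
    rw [pauliOfWord_pauliOfWord, smul_smul, smul_smul]
    congr 1
    simp only [Equiv.coe_addLeft, Submodule.coe_add]
    field_simp
    linear_combination -h1
  · rw [mem_stabilizerSpace] at hv
    have : ∀ c : D, (θ c)⁻¹ • pauliOfWord χ e (c : ι → F) v = v := fun c => by
      rw [hv c c.2, smul_smul, inv_mul_cancel₀ (hθ c c.2).1, one_smul]
    simp only [stabilizerProj, LinearMap.smul_apply, LinearMap.sum_apply, this,
      Finset.sum_const, Finset.card_univ]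
    rw [← Nat.cast_smul_eq_nsmul ℂ, smul_smul, inv_mul_cancel₀, one_smul]
    simp

variable [Fintype K]

lemma trace_pauliOfWord [DecidableEq ι] {χ : AddChar K ℂ} (hχ : χ ≠ 1) (e : F ≃ₗ[K] K × K)
    {c : ι → F} (hc : c ≠ 0) : LinearMap.trace ℂ _ (pauliOfWord χ e c) = 0 := by
  refine trace_pauliEnd hχ _ _ ?_
  by_contra! h
  refine hc (funext fun i => e.map_eq_zero_iff.1 (Prod.ext ?_ ?_))
  · exact congrFun h.1 i
  · exact congrFun h.2 i

lemma trace_pauliOfWord_zero [DecidableEq ι] (χ : AddChar K ℂ) (e : F ≃ₗ[K] K × K) :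
    LinearMap.trace ℂ _ (pauliOfWord χ e (0 : ι → F)) = (Fintype.card K : ℂ) ^ Fintype.card ι := by
  have h : pauliOfWord χ e (0 : ι → F) = LinearMap.id := LinearMap.ext (pauliOfWord_zero χ e)
  rw [h, LinearMap.trace_id]
  simp

/-- The multiplication rule is read off at a nonzero joint eigenvector. It makes `θ c * θ (-c)` a
phase, so `θ c` is nonzero. -/
lemma isEigenvalueSystem_of_ne_bot {χ : AddChar K ℂ} {e : F ≃ₗ[K] K × K}
    {D : Submodule F (ι → F)} {θ : (ι → F) → ℂ} (h : stabilizerSpace χ e D θ ≠ ⊥) :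
    IsEigenvalueSystem χ e D θ := by
  obtain ⟨v, hv, hv0⟩ := Submodule.exists_mem_ne_zero_of_ne_bot h
  rw [mem_stabilizerSpace] at hv
  have hmul : ∀ c ∈ D, ∀ c' ∈ D, θ c * θ c' = χ (pauliPhase e c c') * θ (c + c') := by
    intro c hc c' hc'
    have h1 := pauliOfWord_pauliOfWord χ e c c' v
    rw [hv c' hc', map_smul, hv c hc, hv _ (D.add_mem hc hc'), smul_smul, smul_smul] at h1
    rw [mul_comm]; exact smul_left_injective ℂ hv0 h1
  refine fun c hc => ⟨fun h0 => ?_, hmul c hc⟩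
  have h1 := hmul c hc (-c) (D.neg_mem hc)
  have h2 : θ 0 = 1 := by
    have := hv 0 D.zero_mem
    rw [pauliOfWord_zero] at this
    exact smul_left_injective ℂ hv0 (by simpa using this.symm)
  rw [h0, zero_mul, add_neg_cancel, h2, mul_one] at h1
  have h3 := AddChar.norm_apply χ (pauliPhase e c (-c))
  rw [← h1] at h3
  simp at h3

lemma exists_stabilizerSpace_ne_bot (χ : AddChar K ℂ) (e : F ≃ₗ[K] K × K)
    {D : Submodule F (ι → F)} (hD : ∀ c ∈ D, ∀ c' ∈ D, sympForm e c c' = 0) :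
    ∃ θ, stabilizerSpace χ e D θ ≠ ⊥ := by
  obtain ⟨v, hv0, hv⟩ := exists_common_eigenvector (fun c : D => pauliOfWord χ e (c : ι → F))
    (fun c c' v => by
      show pauliOfWord χ e c.1 (pauliOfWord χ e c'.1 v) = _
      rw [pauliOfWord_comm, hD _ c.2 _ c'.2]; simp)
  choose μ hμ using hv
  classical
  refine ⟨fun c => if h : c ∈ D then μ ⟨c, h⟩ else 0, (Submodule.ne_bot_iff _).2 ⟨v, ?_, hv0⟩⟩
  rw [mem_stabilizerSpace]
  intro c hc
  simpa [hc] using hμ ⟨c, hc⟩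

/-- The dimension is the trace of the projection, to which only the identity operator contributes.
-/
lemma finrank_stabilizerSpace_mul_card [DecidableEq ι] {χ : AddChar K ℂ} (hχ : χ ≠ 1)
    {e : F ≃ₗ[K] K × K} {D : Submodule F (ι → F)} [Fintype D] {θ : (ι → F) → ℂ}
    (h : stabilizerSpace χ e D θ ≠ ⊥) :
    Module.finrank ℂ (stabilizerSpace χ e D θ) * Fintype.card D =
      Fintype.card K ^ Fintype.card ι := by
  have hθ := isEigenvalueSystem_of_ne_bot h
  have ht := (stabilizerProj_isProj hθ).trace
  have h0 : θ 0 = 1 := by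
    have h1 := (hθ 0 D.zero_mem).2 0 D.zero_mem
    have h2 := (hθ 0 D.zero_mem).1
    simp only [pauliPhase, dotProduct, Pi.zero_apply, map_zero, Prod.snd_zero, zero_mul,
      Finset.sum_const_zero, AddChar.map_zero_eq_one, one_mul, add_zero] at h1
    exact mul_right_cancel₀ h2 (h1.trans (one_mul _).symm)
  rw [stabilizerProj, map_smul, map_sum, Finset.sum_eq_single (0 : D)] at ht
  · rw [map_smul, Submodule.coe_zero, trace_pauliOfWord_zero, h0] at ht
    have hc : (Fintype.card D : ℂ) ≠ 0 := by simp
    have : ((Module.finrank ℂ (stabilizerSpace χ e D θ) : ℕ) : ℂ) * Fintype.card D =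
        (Fintype.card K : ℂ) ^ Fintype.card ι := by
      rw [← ht]; simp; field_simp
    exact_mod_cast this
  · intro c _ hc
    rw [map_smul, trace_pauliOfWord hχ e (by simpa using hc), smul_zero]
  · simp

/-- It suffices to treat Pauli errors. One of weight below `d` is either the identity or fails to
commute with a stabilizer operator; in the latter case, moving that unitary through an inner product
multiplies it by a phase other than `1`, so it vanishes. -/
lemma hasDistanceAtLeast_stabilizerSpace [DecidableEq ι] [DecidableEq F] {χ : AddChar K ℂ}
    (hχ : χ ≠ 1) {e : F ≃ₗ[K] K × K} {D : Submodule F (ι → F)} {θ : (ι → F) → ℂ} {d : ℕ}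
    (hd : ∀ u : ι → F, (∀ c ∈ D, sympForm e c u = 0) → hammingNorm u < d → u = 0) :
    HasDistanceAtLeast (stabilizerSpace χ e D θ) d := by
  classical
  intro S hS E hE
  obtain ⟨m, hm⟩ := hE.exists_pauli_expansion hχ
  have key : ∀ a b : S → K, ∃ r : ℂ, ∀ u ∈ stabilizerSpace χ e D θ,
      ∀ v ∈ stabilizerSpace χ e D θ,
        star u ⬝ᵥ pauli χ (extendZero S a) (extendZero S b) v = r * (star u ⬝ᵥ v) := by
    intro a b
    set w : ι → F := fun i => e.symm (extendZero S a i, extendZero S b i) with hw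
    have hwv : ∀ v, pauli χ (extendZero S a) (extendZero S b) v = pauliOfWord χ e w v := by
      intro v; simp [pauliOfWord, hw]
    simp only [hwv]
    by_cases hs : ∀ c ∈ D, sympForm e c w = 0
    · have : w = 0 := by
        refine hd w hs (lt_of_le_of_lt (Finset.card_le_card fun i hi => ?_) hS)
        by_contra h
        simp [hw, extendZero_of_notMem, h] at hi
      exact ⟨1, fun u _ v _ => by rw [this, pauliOfWord_zero, one_mul]⟩
    · push Not at hs
      obtain ⟨c, hc, hcw⟩ := hs
      obtain ⟨r, hr⟩ : ∃ r, χ r ≠ 1 := by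
        by_contra! h; exact hχ (by ext r; simp [h])
      -- A nonzero symplectic product may still lie in the kernel of `χ`; scaling `c` within `D`
      -- turns it into `r`.
      set s := r / sympForm e c w with hs
      have hcs : algebraMap K F s • c ∈ D := D.smul_mem _ hc
      have hph : sympForm e (algebraMap K F s • c) w = r := by
        rw [algebraMap_smul, sympForm_neg, sympForm_smul_right, sympForm_neg, hs]
        field_simp
      refine ⟨0, fun u hu v hv => ?_⟩
      rw [mem_stabilizerSpace] at hu hv
      set c' := algebraMap K F s • c
      have h1 : ∀ x y, star (pauliOfWord χ e c' x) ⬝ᵥ pauliOfWord χ e c' y = star x ⬝ᵥ y :=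
        fun x y => star_pauli_dotProduct_pauli χ _ _ x y
      have h2 := h1 u (pauliOfWord χ e w v)
      rw [pauliOfWord_comm, hph, hu c' hcs, hv c' hcs, map_smul, star_smul, smul_dotProduct,
        dotProduct_smul, dotProduct_smul] at h2
      simp only [smul_eq_mul] at h2
      rw [zero_mul]
      by_contra h0
      have h3 : star (θ c') * θ c' = 1 := by
        by_cases hu0 : star u ⬝ᵥ u = 0
        · rw [dotProduct_star_self_eq_zero] at hu0
          simp [hu0] at h0
        · have := h1 u u
          rw [hu c' hcs, star_smul, smul_dotProduct, dotProduct_smul] at this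
          simp only [smul_eq_mul] at this
          exact mul_right_cancel₀ hu0 (by linear_combination this)
      refine hr (mul_right_cancel₀ h0 ?_)
      linear_combination h2 - χ r * (star u ⬝ᵥ pauliOfWord χ e w v) * h3
  choose r hr using key
  refine ⟨∑ a, ∑ b, m a b * r a b, fun u hu v hv => ?_⟩
  simp only [hm v, dotProduct_sum, dotProduct_smul, hr _ _ u hu v hv, Finset.sum_mul, smul_eq_mul,
    mul_assoc]

/-- The operator of `u` preserves the code, so detectability would make it a nonzero scalar `r`
there. Its composite with the projection would then have trace `r * dim Q`; but that trace is zero,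
since no `u + c` with `c ∈ D` vanishes. -/
lemma not_hasDistanceAtLeast_stabilizerSpace [DecidableEq ι] [DecidableEq K] [DecidableEq F]
    {χ : AddChar K ℂ} (hχ : χ ≠ 1) {e : F ≃ₗ[K] K × K} {D : Submodule F (ι → F)} [Fintype D]
    {θ : (ι → F) → ℂ} (hQ : stabilizerSpace χ e D θ ≠ ⊥) {u : ι → F}
    (hu : ∀ c ∈ D, sympForm e c u = 0) (huD : u ∉ D) :
    ¬ HasDistanceAtLeast (stabilizerSpace χ e D θ) (hammingNorm u + 1) := by
  intro hdist
  have hθ := isEigenvalueSystem_of_ne_bot hQ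
  set Q := stabilizerSpace χ e D θ with hQdef
  obtain ⟨r, hr⟩ := hdist {i | u i ≠ 0} (Nat.lt_succ_self _)
    (pauliMatrix χ (fun i => (e (u i)).1) (fun i => (e (u i)).2))
    (actsOn_pauliMatrix χ (fun i hi => by simp at hi; simp [hi])
      (fun i hi => by simp at hi; simp [hi]))
  have hW : ∀ v, (pauliMatrix χ (fun i => (e (u i)).1) (fun i => (e (u i)).2)).mulVec v =
      pauliOfWord χ e u v := fun v => pauliMatrix_mulVec _ _ _ _
  simp only [hW] at hr
  have hmem : ∀ v ∈ Q, pauliOfWord χ e u v ∈ Q := by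
    intro v hv
    rw [hQdef, mem_stabilizerSpace] at hv ⊢
    intro c hc
    rw [pauliOfWord_comm, hu c hc, hv c hc]; simp
  have hscal : ∀ v ∈ Q, pauliOfWord χ e u v = r • v := by
    intro v hv
    -- This vector is orthogonal to all of `Q`, hence to itself.
    have hs : pauliOfWord χ e u v - r • v ∈ Q := Q.sub_mem (hmem v hv) (Q.smul_mem _ hv)
    have h1 := hr _ hs v hv
    rw [← sub_eq_zero, ← smul_eq_mul, ← dotProduct_smul, ← dotProduct_sub,
      dotProduct_star_self_eq_zero] at h1
    exact sub_eq_zero.1 h1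
  have hr0 : r ≠ 0 := by
    rintro rfl
    obtain ⟨v, hv, hv0⟩ := Submodule.exists_mem_ne_zero_of_ne_bot hQ
    have h1 : star (pauliOfWord χ e u v) ⬝ᵥ pauliOfWord χ e u v = star v ⬝ᵥ v :=
      star_pauli_dotProduct_pauli χ _ _ v v
    rw [hscal v hv] at h1
    simp only [zero_smul, dotProduct_zero] at h1
    exact hv0 (dotProduct_star_self_eq_zero.1 h1.symm)
  have hP := stabilizerProj_isProj hθ
  have hcomp : pauliOfWord χ e u ∘ₗ stabilizerProj χ e D θ = r • stabilizerProj χ e D θ :=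
    LinearMap.ext fun v => hscal _ (hP.map_mem v)
  have htr : LinearMap.trace ℂ _ (pauliOfWord χ e u ∘ₗ stabilizerProj χ e D θ) = 0 := by
    have hexp : pauliOfWord χ e u ∘ₗ stabilizerProj χ e D θ = (Fintype.card D : ℂ)⁻¹ •
        ∑ c : D, (θ c)⁻¹ • χ (pauliPhase e u c) • pauliOfWord χ e (u + (c : ι → F)) := by
      refine LinearMap.ext fun v => ?_
      simp only [stabilizerProj, LinearMap.comp_apply, LinearMap.smul_apply, LinearMap.sum_apply,
        map_smul, map_sum, pauliOfWord_pauliOfWord]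
    rw [hexp, map_smul, map_sum, Finset.sum_eq_zero, smul_zero]
    intro c _
    rw [map_smul, map_smul, trace_pauliOfWord hχ, smul_zero, smul_zero]
    intro h
    have h' : u = -(c : ι → F) := eq_neg_of_add_eq_zero_left h
    exact huD (h' ▸ D.neg_mem c.2)
  rw [hcomp, map_smul, hP.trace, smul_eq_mul, mul_eq_zero, Nat.cast_eq_zero,
    Submodule.finrank_eq_zero] at htr
  exact htr.elim hr0 hQ

end StabilizerCodes

/-! ### Hermitian and symplectic duality -/

section HermitianSymplectic

variable {ι : Type*} [Fintype ι] {K F : Type*} [Field K] [Field F] [Algebra K F]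

lemma finrank_eq_two_of_linearEquiv (e : F ≃ₗ[K] K × K) : Module.finrank K F = 2 := by
  rw [e.finrank_eq, Module.finrank_prod, Module.finrank_self]

variable [Fintype K]

lemma natCard_of_finrank_eq_two (hF : Module.finrank K F = 2) :
    Nat.card F = Fintype.card K ^ 2 := by
  have : Module.Finite K F := Module.finite_of_finrank_pos (by omega)
  rw [Module.natCard_eq_pow_finrank (K := K), hF, Nat.card_eq_fintype_card]

lemma pow_card_pow_card (hF : Module.finrank K F = 2) (u : F) :
    (u ^ Fintype.card K) ^ Fintype.card K = u := by
  have : Module.Finite K F := Module.finite_of_finrank_pos (by omega)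
  have : Finite F := Module.finite_of_finite K
  have := Fintype.ofFinite F
  rw [← pow_mul, ← sq, ← natCard_of_finrank_eq_two hF, Nat.card_eq_fintype_card,
    FiniteField.pow_card]

lemma exists_pow_card_ne (hF : Module.finrank K F = 2) : ∃ u : F, u ^ Fintype.card K ≠ u := by
  by_contra! h
  have : Module.Finite K F := Module.finite_of_finrank_pos (by omega)
  have : Finite F := Module.finite_of_finite K
  have h1 : FiniteField.frobeniusAlgHom K F = 1 := AlgHom.ext h
  have h2 := FiniteField.orderOf_frobeniusAlgHom K F
  rw [h1, orderOf_one, hF] at h2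
  omega

lemma sum_pow_card {I : Type*} (s : Finset I) (f : I → F) :
    (∑ i ∈ s, f i) ^ Fintype.card K = ∑ i ∈ s, f i ^ Fintype.card K :=
  map_sum (FiniteField.frobeniusAlgHom K F) f s

/-- The alternating `K`-bilinear form `u ^ q * v - u * v ^ q` on `F` is a nonzero multiple of the
determinant form in coordinates. -/
lemma exists_pow_card_mul_sub_eq (e : F ≃ₗ[K] K × K) : ∃ δ : F, δ ≠ 0 ∧ ∀ u v : F,
    u ^ Fintype.card K * v - u * v ^ Fintype.card K =
      δ * algebraMap K F ((e u).2 * (e v).1 - (e v).2 * (e u).1) := by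
  set s := e.symm (1, 0)
  set t := e.symm (0, 1)
  have hdec : ∀ u, u = algebraMap K F (e u).1 * s + algebraMap K F (e u).2 * t := by
    intro u
    apply e.injective
    rw [← Algebra.smul_def, ← Algebra.smul_def, map_add, map_smul, map_smul]
    simp [s, t]
  have hpow : ∀ u, u ^ Fintype.card K = algebraMap K F (e u).1 * s ^ Fintype.card K +
      algebraMap K F (e u).2 * t ^ Fintype.card K := by
    intro u
    have := congrArg (FiniteField.frobeniusAlgHom K F) (hdec u)
    rw [map_add, map_mul, map_mul, AlgHom.commutes, AlgHom.commutes] at this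
    exact this
  have key : ∀ u v : F, u ^ Fintype.card K * v - u * v ^ Fintype.card K =
      (t ^ Fintype.card K * s - t * s ^ Fintype.card K) *
        algebraMap K F ((e u).2 * (e v).1 - (e v).2 * (e u).1) := by
    intro u v
    rw [hpow u, hpow v, map_sub, map_mul, map_mul]
    linear_combination (algebraMap K F (e u).1 * s ^ Fintype.card K +
      algebraMap K F (e u).2 * t ^ Fintype.card K) * hdec v -
      (algebraMap K F (e v).1 * s ^ Fintype.card K +
      algebraMap K F (e v).2 * t ^ Fintype.card K) * hdec u
  refine ⟨_, fun h0 => ?_, key⟩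
  obtain ⟨u, hu⟩ := exists_pow_card_ne (finrank_eq_two_of_linearEquiv e)
  have := key u 1
  rw [h0, zero_mul, one_pow, mul_one, mul_one, sub_eq_zero] at this
  exact hu this

/-- For the Hermitian product `S` of `c` and `u`, `S - S ^ q` is a nonzero multiple of the
symplectic product. If the latter vanishes on all `F`-multiples of `c`, then `r ^ q * S = r * S` for
every `r`, so `S = 0`. -/
lemma mem_hermitianDual_iff_sympForm (e : F ≃ₗ[K] K × K) (D : Submodule F (ι → F)) (u : ι → F) :
    u ∈ hermitianDual (Fintype.card K) D ↔ ∀ c ∈ D, sympForm e c u = 0 := by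
  have hF := finrank_eq_two_of_linearEquiv e
  obtain ⟨δ, hδ, hform⟩ := exists_pow_card_mul_sub_eq e
  have hsum : ∀ c : ι → F, ∑ i, c i ^ Fintype.card K * u i -
      (∑ i, c i ^ Fintype.card K * u i) ^ Fintype.card K =
        δ * algebraMap K F (sympForm e c u) := by
    intro c
    simp only [sum_pow_card, mul_pow, pow_card_pow_card hF, ← Finset.sum_sub_distrib, hform,
      sympForm, map_sum, Finset.mul_sum]
  refine ⟨fun hu c hc => ?_, fun hs c hc => ?_⟩
  · have h1 := hsum c
    rw [hu c hc, zero_pow Fintype.card_ne_zero, sub_zero, zero_eq_mul, or_iff_right hδ] at h1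
    exact (map_eq_zero _).1 h1
  · by_contra h0
    have hfix : ∀ r : F, r ^ Fintype.card K = r := by
      intro r
      have h1 := hsum c
      have h2 := hsum (r • c)
      rw [hs _ hc, map_zero, mul_zero, sub_eq_zero] at h1
      rw [hs _ (D.smul_mem r hc), map_zero, mul_zero, sub_eq_zero] at h2
      simp only [Pi.smul_apply, smul_eq_mul, mul_pow, mul_assoc, ← Finset.mul_sum] at h2
      rw [pow_card_pow_card hF, ← h1] at h2
      exact mul_right_cancel₀ h0 h2
    obtain ⟨r, hr⟩ := exists_pow_card_ne hF
    exact hr (hfix r)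

end HermitianSymplectic

/-! ### MDS codes and their Hermitian duals -/

section MDS

variable {ι F : Type*} [Field F]

lemma mem_rescale {C : Submodule F (ι → F)} {y u : ι → F} : u ∈ rescale y C ↔ ∃ c ∈ C, u = fun i => y i * c i := by
  simp only [rescale, Submodule.mem_map]
  refine exists_congr fun c => and_congr_right fun _ => ?_
  rw [eq_comm]; rfl

/-- For any `k` coordinates, some word of `C` is nonzero at a given one of them and vanishes at the
others. -/
def SeparatesCoordinates (C : Submodule F (ι → F)) (k : ℕ) : Prop :=
  ∀ T : Finset ι, T.card = k → ∀ i ∈ T, ∃ c ∈ C, c i ≠ 0 ∧ ∀ j ∈ T, j ≠ i → c j = 0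

variable {C : Submodule F (ι → F)} {k : ℕ}

lemma SeparatesCoordinates.rescale (h : SeparatesCoordinates C k) {y : ι → F}
    (hy : ∀ i, y i ≠ 0) : SeparatesCoordinates (rescale y C) k := by
  intro T hT i hi
  obtain ⟨c, hc, hci, hcj⟩ := h T hT i hi
  exact ⟨_, mem_rescale.2 ⟨c, hc, rfl⟩, mul_ne_zero (hy i) hci,
    fun j hj hji => by simp [hcj j hj hji]⟩

variable [Fintype ι]

lemma SeparatesCoordinates.restrict_surjective (h : SeparatesCoordinates C k) {T : Finset ι}
    (hT : T.card = k) :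
    Function.Surjective ((LinearMap.funLeft F F ((↑) : T → ι)).domRestrict C) := by
  classical
  rw [← LinearMap.range_eq_top, eq_top_iff, ← (Pi.basisFun F T).span_eq, Submodule.span_le]
  rintro _ ⟨i, rfl⟩
  obtain ⟨c, hc, hci, hcj⟩ := h T hT i i.2
  refine ⟨⟨(c i)⁻¹ • c, C.smul_mem _ hc⟩, funext fun j => ?_⟩
  by_cases hj : j = i
  · subst hj; simp [LinearMap.funLeft_apply, hci]
  · simp [LinearMap.funLeft_apply, hcj j j.2 fun h => hj (Subtype.ext h), hj]

lemma SeparatesCoordinates.finrank_eq (h : SeparatesCoordinates C k)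
    (hk : k ≤ Fintype.card ι) (hC : Module.finrank F C ≤ k) : Module.finrank F C = k := by
  obtain ⟨T, -, hT⟩ := Finset.exists_superset_card_eq (s := (∅ : Finset ι)) (n := k) (by simp) hk
  refine le_antisymm hC ?_
  have := LinearMap.finrank_le_finrank_of_surjective (h.restrict_surjective hT)
  simpa [hT] using this

/-- Restriction to any `k` coordinates is onto a space of the same dimension, hence injective on
`C`. -/
lemma SeparatesCoordinates.lt_hammingNorm [DecidableEq F] (h : SeparatesCoordinates C k)
    (hk : k ≤ Fintype.card ι) (hC : Module.finrank F C ≤ k) {c : ι → F} (hc : c ∈ C)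
    (hc0 : c ≠ 0) : Fintype.card ι < hammingNorm c + k := by
  classical
  by_contra! hlt
  have hcard : hammingNorm c + (Finset.univ.filter fun i => c i = 0).card = Fintype.card ι := by
    rw [hammingNorm, add_comm]
    simpa using Finset.card_filter_add_card_filter_not (s := (Finset.univ : Finset ι))
      (fun i => c i = 0)
  obtain ⟨T, hTs, hT⟩ := Finset.exists_subset_card_eq
    (show k ≤ (Finset.univ.filter fun i => c i = 0).card by omega)
  have hinj := (LinearMap.injective_iff_surjective_of_finrank_eq_finrank
    (by simp [hT, h.finrank_eq hk hC])).2 (h.restrict_surjective hT)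
  refine hc0 (congrArg Subtype.val (@hinj ⟨c, hc⟩ 0 (funext fun i => ?_)))
  have := hTs i.2
  simpa [LinearMap.funLeft_apply] using this

/-- Pairing `u` with a word that isolates one coordinate of a `k`-set containing the support shows
that this coordinate of `u` is zero. -/
lemma SeparatesCoordinates.eq_zero_of_mem_hermitianDual [DecidableEq F]
    (h : SeparatesCoordinates C k) (hk : k ≤ Fintype.card ι) {q : ℕ} (hq : q ≠ 0) {u : ι → F}
    (hu : u ∈ hermitianDual q C) (huk : hammingNorm u ≤ k) : u = 0 := by
  classical
  obtain ⟨T, hsT, hT⟩ := Finset.exists_superset_card_eq huk hk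
  have hout : ∀ i, i ∉ T → u i = 0 := fun i hi => by
    by_contra h0; exact hi (hsT (by simpa using h0))
  funext i
  by_cases hi : i ∈ T
  · obtain ⟨c, hc, hci, hcj⟩ := h T hT i hi
    have h1 := hu c hc
    rw [Finset.sum_eq_single i] at h1
    · simpa [hci] using h1
    · intro j _ hj
      by_cases hjT : j ∈ T
      · rw [hcj j hjT hj, zero_pow hq, zero_mul]
      · rw [hout j hjT, mul_zero]
    · simp
  · exact hout i hi

variable {K : Type*} [Field K] [Fintype K] [Algebra K F]

lemma le_finrank_hermitianDual (K : Type*) [Field K] [Fintype K] [Algebra K F]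
    (C : Submodule F (ι → F)) :
    Fintype.card ι ≤ Module.finrank F (hermitianDual (Fintype.card K) C) + Module.finrank F C := by
  let b := Module.finBasis F C
  let Φ : (ι → F) →ₗ[F] (Fin (Module.finrank F C) → F) :=
    LinearMap.pi fun s => ∑ i, ((b s : ι → F) i ^ Fintype.card K) • LinearMap.proj i
  have hker : LinearMap.ker Φ ≤ hermitianDual (Fintype.card K) C := by
    intro v hv c hc
    have hv' : ∀ s, ∑ i, (b s : ι → F) i ^ Fintype.card K * v i = 0 := fun s => by
      simpa [Φ] using congrFun (LinearMap.mem_ker.1 hv) s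
    have hc' : ∀ i, c i = ∑ s, b.repr ⟨c, hc⟩ s * (b s : ι → F) i := fun i => by
      have h1 := congrFun (congrArg C.subtype (b.sum_repr ⟨c, hc⟩)) i
      rw [map_sum, Finset.sum_apply] at h1
      exact h1.symm
    simp only [hc', sum_pow_card, mul_pow, Finset.sum_mul, mul_assoc]
    rw [Finset.sum_comm]
    simp [← Finset.mul_sum, hv']
  have h1 := LinearMap.finrank_range_add_finrank_ker Φ
  have h2 := Submodule.finrank_mono hker
  have h3 := (LinearMap.range Φ).finrank_le
  simp at h1 h3
  omega

lemma SeparatesCoordinates.finrank_hermitianDual [DecidableEq F] (h : SeparatesCoordinates C k)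
    (hk : k ≤ Fintype.card ι) (hC : Module.finrank F C ≤ k) :
    Module.finrank F (hermitianDual (Fintype.card K) C) = Fintype.card ι - k := by
  classical
  have h1 := le_finrank_hermitianDual K C
  refine le_antisymm ?_ (by omega)
  obtain ⟨T, -, hT⟩ := Finset.exists_superset_card_eq (s := (∅ : Finset ι)) (n := k) (by simp) hk
  have hinj : Function.Injective ((LinearMap.funLeft F F ((↑) : (Tᶜ : Finset ι) → ι)).domRestrict
      (hermitianDual (Fintype.card K) C)) := by
    rw [← LinearMap.ker_eq_bot, LinearMap.ker_eq_bot']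
    intro u hu
    refine Subtype.ext (h.eq_zero_of_mem_hermitianDual hk Fintype.card_ne_zero u.2 ?_)
    rw [← hT]
    refine Finset.card_le_card fun i hi => ?_
    by_contra hiT
    have := congrFun hu ⟨i, by simpa using hiT⟩
    simp only [Finset.mem_filter] at hi
    exact hi.2 (by simpa [LinearMap.funLeft_apply] using this)
  have := LinearMap.finrank_le_finrank_of_injective hinj
  simpa [Finset.card_compl, hT] using this

/-- Vanishing outside a set of `k + 1` coordinates imposes `n - k - 1` conditions on a space of
dimension `n - k`, where `n` is the length. -/
lemma SeparatesCoordinates.exists_hammingNorm_eq [DecidableEq F] (h : SeparatesCoordinates C k)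
    (hk : k < Fintype.card ι) (hC : Module.finrank F C ≤ k) :
    ∃ u ∈ hermitianDual (Fintype.card K) C, u ≠ 0 ∧ hammingNorm u = k + 1 := by
  classical
  obtain ⟨T, -, hT⟩ := Finset.exists_superset_card_eq (s := (∅ : Finset ι)) (n := k + 1)
    (by simp) hk
  have hker := LinearMap.ker_ne_bot_of_finrank_lt (f :=
      (LinearMap.funLeft F F ((↑) : (Tᶜ : Finset ι) → ι)).domRestrict
        (hermitianDual (Fintype.card K) C)) (by
    rw [h.finrank_hermitianDual hk.le hC]
    simp [hT]; omega)
  obtain ⟨u, hu, hu0⟩ := Submodule.exists_mem_ne_zero_of_ne_bot hker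
  have hu0' : (u : ι → F) ≠ 0 := by simpa using hu0
  refine ⟨u, u.2, hu0', le_antisymm ?_ ?_⟩
  · rw [← hT]
    refine Finset.card_le_card fun i hi => ?_
    by_contra hiT
    have := congrFun hu ⟨i, by simpa using hiT⟩
    simp only [Finset.mem_filter] at hi
    exact hi.2 (by simpa [LinearMap.funLeft_apply] using this)
  · by_contra! hlt
    exact hu0' (h.eq_zero_of_mem_hermitianDual hk.le Fintype.card_ne_zero u.2 (by omega))

lemma SeparatesCoordinates.isMDSCode_hermitianDual [DecidableEq F]
    (h : SeparatesCoordinates C k) (hk : k < Fintype.card ι) (hC : Module.finrank F C ≤ k) :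
    IsMDSCode (hermitianDual (Fintype.card K) C) (Fintype.card ι - k) (k + 1) := by
  refine ⟨⟨h.finrank_hermitianDual hk.le hC, h.exists_hammingNorm_eq hk hC, ?_⟩, by omega⟩
  rintro w ⟨u, hu, hu0, rfl⟩
  by_contra! hlt
  exact hu0 (h.eq_zero_of_mem_hermitianDual hk.le Fintype.card_ne_zero hu (by omega))

lemma finrank_rescale_le (y : ι → F) (C : Submodule F (ι → F)) :
    Module.finrank F (rescale y C) ≤ Module.finrank F C :=
  Submodule.finrank_map_le _ _

end MDS

/-- A Hermitian self-orthogonal code of dimension `k` with MDS dual yields a quantum MDS code. -/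
theorem SeparatesCoordinates.exists_isQuantumMDSCode {ι : Type*} [Fintype ι] [DecidableEq ι]
    {K F : Type*} [Field K] [Fintype K] [DecidableEq K] [Field F] [DecidableEq F] [Algebra K F]
    {χ : AddChar K ℂ} (hχ : χ ≠ 1) (e : F ≃ₗ[K] K × K) {D : Submodule F (ι → F)} {k : ℕ}
    (h : SeparatesCoordinates D k) (hD : Module.finrank F D ≤ k) (hk : 2 * k < Fintype.card ι)
    (hself : D ≤ hermitianDual (Fintype.card K) D) :
    ∃ Q : Submodule ℂ ((ι → K) → ℂ), IsStabilizerCodeOf χ e D Q ∧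
      IsQuantumMDSCode Q (Fintype.card ι - 2 * k) (k + 1) := by
  have : Module.Finite K F := Module.Finite.equiv e.symm
  have : Finite F := Module.finite_of_finite K
  have := Fintype.ofFinite F
  have := Fintype.ofFinite D
  have hkn : k ≤ Fintype.card ι := by omega
  obtain ⟨θ, hθ⟩ := exists_stabilizerSpace_ne_bot χ e (D := D)
    fun c hc c' hc' => (mem_hermitianDual_iff_sympForm e D c').1 (hself hc') c hc
  refine ⟨stabilizerSpace χ e D θ, ⟨hθ, θ, fun v => mem_stabilizerSpace⟩,
    ⟨?_, ?_, ?_⟩, by omega⟩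
  · have h1 := finrank_stabilizerSpace_mul_card hχ hθ
    have h2 : Fintype.card D = Fintype.card K ^ (2 * k) := by
      rw [← Nat.card_eq_fintype_card, Module.natCard_eq_pow_finrank (K := F), h.finrank_eq hkn hD,
        natCard_of_finrank_eq_two (finrank_eq_two_of_linearEquiv e), pow_mul]
    rw [h2] at h1
    refine Nat.eq_of_mul_eq_mul_right (Nat.pow_pos (n := 2 * k) Fintype.card_pos) (h1.trans ?_)
    rw [← pow_add, Nat.sub_add_cancel hk.le]
  · refine hasDistanceAtLeast_stabilizerSpace hχ fun u hu huk => ?_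
    exact h.eq_zero_of_mem_hermitianDual hkn Fintype.card_ne_zero
      ((mem_hermitianDual_iff_sympForm e D u).2 hu) (by omega)
  · obtain ⟨u, hu, hu0, hun⟩ := h.exists_hammingNorm_eq (K := K) (by omega) hD
    rw [← hun]
    refine not_hasDistanceAtLeast_stabilizerSpace hχ hθ
      ((mem_hermitianDual_iff_sympForm e D u).1 hu) fun huD => ?_
    -- Nonzero words of `D` have weight above `n - k`, which is at least `k + 1`.
    have := h.lt_hammingNorm hkn hD huD hu0
    omega

/-! ### Binary forms as functions on a plane -/

section BinaryForms

variable (F E : Type*) [Field F] [Field E] [Algebra F E]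

/-- The linear forms on `E` with values in `F`, as functions. The power `linForms F E ^ m` consists
of the forms of degree `m`. -/
def linForms : Submodule F (E → F) := LinearMap.range (LinearMap.ltoFun F E F F)

variable {F E}

lemma linearMap_mem_linForms (l : E →ₗ[F] F) : (l : E → F) ∈ linForms F E := ⟨l, rfl⟩

lemma map_smul_of_mem_linForms_pow {m : ℕ} {f : E → F} (hf : f ∈ linForms F E ^ m) (a : F)
    (z : E) : f (a • z) = a ^ m * f z := by
  induction hf using Submodule.pow_induction_on_left' with
  | algebraMap r => simp
  | add x y i hx hy h1 h2 => rw [Pi.add_apply, Pi.add_apply, h1, h2]; ring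
  | mem_mul l hl i x hx h =>
    obtain ⟨l, rfl⟩ := hl
    simp only [Pi.mul_apply, h, LinearMap.ltoFun_apply, map_smul, smul_eq_mul,
      Nat.succ_eq_add_one]
    ring

lemma comp_mem_linForms_pow {m : ℕ} {f : E → F} (hf : f ∈ linForms F E ^ m) (T : E →ₗ[F] E) :
    (fun z => f (T z)) ∈ linForms F E ^ m := by
  induction hf using Submodule.pow_induction_on_left' with
  | algebraMap r => exact (pow_zero (linForms F E)).symm ▸ Submodule.algebraMap_mem r
  | add x y i hx hy h1 h2 => exact add_mem h1 h2
  | mem_mul l hl i x hx h =>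
    obtain ⟨l, rfl⟩ := hl
    rw [Nat.succ_eq_add_one, pow_succ']
    exact Submodule.mul_mem_mul (linearMap_mem_linForms (l ∘ₗ T)) h

lemma mul_mem_linForms_pow {m n : ℕ} {f g : E → F} (hf : f ∈ linForms F E ^ m)
    (hg : g ∈ linForms F E ^ n) : f * g ∈ linForms F E ^ (m + n) := by
  rw [pow_add]; exact Submodule.mul_mem_mul hf hg

lemma pow_mem_linForms_pow {m : ℕ} {f : E → F} (hf : f ∈ linForms F E ^ m) (n : ℕ) :
    f ^ n ∈ linForms F E ^ (m * n) := by
  rw [pow_mul]; exact Submodule.pow_mem_pow _ hf n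

lemma prod_mem_linForms_pow {ι : Type*} (s : Finset ι) (l : ι → E →ₗ[F] F) :
    (∏ i ∈ s, (l i : E → F)) ∈ linForms F E ^ s.card := by
  classical
  induction s using Finset.induction_on with
  | empty => exact (pow_zero (linForms F E)).symm ▸ Submodule.one_le.1 le_rfl
  | insert i s hi ih =>
    rw [Finset.prod_insert hi, Finset.card_insert_of_notMem hi, pow_succ']
    exact Submodule.mul_mem_mul (linearMap_mem_linForms _) ih

/-- The monomials of degree `m` in the coordinates of a basis. -/
def monomialForms (b : Module.Basis (Fin 2) F E) (m : ℕ) : Set (E → F) :=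
  Set.range fun s : Fin (m + 1) => (b.coord 0 : E → F) ^ (s : ℕ) * (b.coord 1 : E → F) ^ (m - s)

lemma mem_monomialForms (b : Module.Basis (Fin 2) F E) {m s t : ℕ} (h : s + t = m) :
    (b.coord 0 : E → F) ^ s * (b.coord 1 : E → F) ^ t ∈ monomialForms b m :=
  ⟨⟨s, by omega⟩, by simp [← h]⟩

lemma linForms_pow_le_span (b : Module.Basis (Fin 2) F E) (m : ℕ) :
    linForms F E ^ m ≤ Submodule.span F (monomialForms b m) := by
  induction m with
  | zero =>
    rw [pow_zero, Submodule.one_le]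
    exact Submodule.subset_span (by simpa using mem_monomialForms b (s := 0) (t := 0) rfl)
  | succ m ih =>
    have h1 : linForms F E ≤ Submodule.span F {(b.coord 0 : E → F), (b.coord 1 : E → F)} := by
      rintro _ ⟨l, rfl⟩
      rw [Submodule.mem_span_pair]
      refine ⟨l (b 0), l (b 1), funext fun z => ?_⟩
      have := congrArg l (b.sum_repr z)
      rw [Fin.sum_univ_two, map_add, map_smul, map_smul] at this
      simpa [mul_comm] using this
    rw [pow_succ]
    refine (mul_le_mul' ih h1).trans ?_
    rw [Submodule.span_mul_span]
    refine Submodule.span_mono (Set.mul_subset_iff.2 ?_)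
    rintro _ ⟨s, rfl⟩ _ (rfl | rfl)
    · have := mem_monomialForms b (m := m + 1) (s := s + 1) (t := m - s) (by omega)
      convert this using 1; ring
    · have := mem_monomialForms b (m := m + 1) (s := s) (t := m - s + 1) (by omega)
      convert this using 1; ring

lemma finrank_linForms_pow_le (hE : Module.finrank F E = 2) (m : ℕ) :
    Module.Finite F (linForms F E ^ m : Submodule F (E → F)) ∧
      Module.finrank F (linForms F E ^ m : Submodule F (E → F)) ≤ m + 1 := by
  have : Module.Finite F E := Module.finite_of_finrank_pos (by omega)
  let b := Module.finBasisOfFinrankEq F E hE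
  have hfin : Module.Finite F (Submodule.span F (monomialForms b m)) :=
    Module.Finite.span_of_finite F (Set.finite_range _)
  refine ⟨Submodule.finiteDimensional_of_le (linForms_pow_le_span b m), ?_⟩
  refine (Submodule.finrank_mono (linForms_pow_le_span b m)).trans ?_
  have := finrank_range_le_card (R := F) fun s : Fin (m + 1) =>
    (b.coord 0 : E → F) ^ (s : ℕ) * (b.coord 1 : E → F) ^ (m - s)
  rw [Fintype.card_fin] at this
  exact this

lemma norm_mem_linForms_sq (hE : Module.finrank F E = 2) :
    (fun z : E => Algebra.norm F z) ∈ linForms F E ^ 2 := by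
  have : Module.Finite F E := Module.finite_of_finrank_pos (by omega)
  let b := Module.finBasisOfFinrankEq F E hE
  have hent : ∀ i j, (fun z => Algebra.leftMulMatrix b z i j) ∈ linForms F E := fun i j =>
    linearMap_mem_linForms ((Matrix.entryLinearMap F F i j) ∘ₗ
      (Algebra.leftMulMatrix b).toLinearMap)
  have : (fun z : E => Algebra.norm F z) =
      (fun z => Algebra.leftMulMatrix b z 0 0) * (fun z => Algebra.leftMulMatrix b z 1 1) -
      (fun z => Algebra.leftMulMatrix b z 0 1) * (fun z => Algebra.leftMulMatrix b z 1 0) := by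
    funext z
    rw [Algebra.norm_eq_matrix_det b, Matrix.det_fin_two]
    rfl
  rw [this, sq]
  exact sub_mem (Submodule.mul_mem_mul (hent _ _) (hent _ _))
    (Submodule.mul_mem_mul (hent _ _) (hent _ _))

/-- The sum of a monomial over the plane is a product of two power sums. Their exponents add up to
`|F| - 1`, so one of them is smaller than that and its power sum is zero. -/
lemma sum_eq_zero_of_mem_linForms_pow [Fintype F] [Fintype E] (hE : Module.finrank F E = 2)
    {w : E → F} (hw : w ∈ linForms F E ^ (Fintype.card F - 1)) : ∑ z, w z = 0 := by
  have : Module.Finite F E := Module.finite_of_finrank_pos (by omega)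
  let b := Module.finBasisOfFinrankEq F E hE
  have hF : 1 < Fintype.card F := Fintype.one_lt_card
  refine Submodule.span_induction (p := fun f _ => ∑ z, f z = 0) ?_ (by simp) ?_ ?_
    (linForms_pow_le_span b _ hw)
  · rintro _ ⟨s, rfl⟩
    have hs : (s : ℕ) ≤ Fintype.card F - 1 := by omega
    rw [Fintype.sum_equiv (b.equivFun.toEquiv.trans (finTwoArrowEquiv F)) _
      (fun z : F × F => z.1 ^ (s : ℕ) * z.2 ^ (Fintype.card F - 1 - s))
      (fun z => by simp [finTwoArrowEquiv]), Fintype.sum_prod_type]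
    simp only [← Finset.mul_sum, ← Finset.sum_mul]
    rcases hs.lt_or_eq with h | h
    · rw [FiniteField.sum_pow_lt_card_sub_one F s h, zero_mul]
    · rw [FiniteField.sum_pow_lt_card_sub_one F (Fintype.card F - 1 - s) (by omega), mul_zero]
  · intro f g _ _ hf hg
    simp [Finset.sum_add_distrib, hf, hg]
  · intro a f _ hf
    simp [← Finset.mul_sum, hf]

/-- The code of evaluations of the forms of degree `m` at the points `1, η, …, η ^ N`. -/
def formCode (F : Type*) {E : Type*} [Field F] [Field E] [Algebra F E] (η : E) (N m : ℕ) :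
    Submodule F (Fin (N + 1) → F) :=
  (linForms F E ^ m).map (LinearMap.funLeft F F fun i : Fin (N + 1) => η ^ (i : ℕ))

lemma mem_formCode {η : E} {N m : ℕ} {c : Fin (N + 1) → F} : c ∈ formCode F η N m ↔
    ∃ f ∈ linForms F E ^ m, c = fun i : Fin (N + 1) => f (η ^ (i : ℕ)) := by
  simp only [formCode, Submodule.mem_map]
  refine exists_congr fun c => and_congr_right fun _ => ?_
  rw [eq_comm]; rfl

lemma finrank_formCode_le (hE : Module.finrank F E = 2) (η : E) (N m : ℕ) :
    Module.finrank F (formCode F η N m) ≤ m + 1 := by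
  have := (finrank_linForms_pow_le hE m).1
  exact (Submodule.finrank_map_le _ _).trans (finrank_linForms_pow_le hE m).2

end BinaryForms

/-! ### Points of the projective line as powers of a generator -/

section ProjectivePoints

variable {F E : Type*} [Field F] [Fintype F] [Field E] [Algebra F E]

lemma exists_generator_powers (E : Type*) [Field E] [Finite E] : ∃ η : E, η ≠ 0 ∧
    orderOf η = Nat.card E - 1 ∧ ∀ z : E, z ≠ 0 → ∃ m : ℕ, z = η ^ m := by
  obtain ⟨g, hg⟩ := IsCyclic.exists_generator (α := Eˣ)
  refine ⟨g, g.ne_zero, ?_, fun z hz => ?_⟩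
  · rw [orderOf_units, orderOf_eq_card_of_forall_mem_zpowers hg, Nat.card_units]
  · obtain ⟨m, hm⟩ := mem_powers_iff_mem_zpowers.2 (hg (Units.mk0 z hz))
    exact ⟨m, by simpa using (congrArg Units.val hm).symm⟩

/-- Raising to the power `|F| - 1` kills the scalars and leaves exponents below the order of `η`. -/
lemma eq_of_smul_pow_eq_smul_pow (hE : Module.finrank F E = 2) {η : E}
    (hη : orderOf η = Nat.card E - 1) {a a' : F} (ha : a ≠ 0) (ha' : a' ≠ 0) {i j : ℕ}
    (hi : i < Fintype.card F + 1) (hj : j < Fintype.card F + 1) (h : a • η ^ i = a' • η ^ j) :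
    i = j := by
  have hF : 1 < Fintype.card F := Fintype.one_lt_card
  have h1 := congrArg (· ^ (Fintype.card F - 1)) h
  simp only [smul_pow, FiniteField.pow_card_sub_one_eq_one _ ha,
    FiniteField.pow_card_sub_one_eq_one _ ha', one_smul, ← pow_mul] at h1
  rw [natCard_of_finrank_eq_two hE] at hη
  have hlt : ∀ l, l < Fintype.card F + 1 → l * (Fintype.card F - 1) < Fintype.card F ^ 2 - 1 := by
    intro l hl
    obtain ⟨r, hr⟩ := Nat.exists_eq_add_of_lt hF
    rw [hr] at hl ⊢
    have h2 : (1 + r + 1) ^ 2 - 1 = (1 + r + 2) * (r + 1) := by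
      rw [Nat.sub_eq_iff_eq_add (Nat.one_le_pow _ _ (by omega))]; ring
    rw [h2, show 1 + r + 1 - 1 = r + 1 by omega]
    exact Nat.mul_lt_mul_of_pos_right (by omega) (by omega)
  have h3 := pow_injOn_Iio_orderOf (x := η) (by simpa [hη] using hlt i hi)
    (by simpa [hη] using hlt j hj) h1
  exact Nat.eq_of_mul_eq_mul_right (by omega) h3

lemma separatesCoordinates_formCode (hE : Module.finrank F E = 2) {η : E} (hη0 : η ≠ 0)
    (hη : orderOf η = Nat.card E - 1) {N : ℕ} (hN : Fintype.card F = N) (m : ℕ) :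
    SeparatesCoordinates (formCode F η N m) (m + 1) := by
  subst hN
  intro T hT i hi
  have hex : ∀ j : Fin (Fintype.card F + 1), ∃ l : E →ₗ[F] F, j ≠ i →
      l (η ^ (i : ℕ)) ≠ 0 ∧ l (η ^ (j : ℕ)) = 0 := by
    intro j
    by_cases hj : j = i
    · exact ⟨0, fun h => absurd hj h⟩
    · have hnot : η ^ (i : ℕ) ∉ Submodule.span F {η ^ (j : ℕ)} := by
        intro h
        obtain ⟨a, ha⟩ := Submodule.mem_span_singleton.1 h
        have ha0 : a ≠ 0 := by
          rintro rfl
          exact pow_ne_zero (i : ℕ) hη0 (by rw [← ha, zero_smul])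
        exact hj (Fin.ext (eq_of_smul_pow_eq_smul_pow hE hη ha0 one_ne_zero j.2 i.2
          (by rw [ha, one_smul])))
      obtain ⟨l, hl, hker⟩ := Submodule.exists_le_ker_of_notMem hnot
      exact ⟨l, fun _ => ⟨hl, hker (Submodule.mem_span_singleton_self _)⟩⟩
  choose l hl using hex
  have hmem := prod_mem_linForms_pow (T.erase i) l
  rw [Finset.card_erase_of_mem hi, hT, Nat.add_sub_cancel] at hmem
  refine ⟨_, mem_formCode.2 ⟨_, hmem, rfl⟩, ?_, fun j hj hji => ?_⟩
  · simp only [Finset.prod_apply]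
    exact Finset.prod_ne_zero_iff.2 fun j hj => (hl j (Finset.ne_of_mem_erase hj)).1
  · simp only [Finset.prod_apply]
    exact Finset.prod_eq_zero (Finset.mem_erase.2 ⟨hji, hj⟩) (hl j hji).2

variable [Finite E]

lemma algebraMap_norm_eq_pow_card_add_one (hE : Module.finrank F E = 2) (z : E) :
    algebraMap F E (Algebra.norm F z) = z ^ (Fintype.card F + 1) := by
  rw [FiniteField.algebraMap_norm_eq_pow_sum, hE, Finset.sum_range_succ, Finset.sum_range_one,
    pow_zero, pow_one, Nat.card_eq_fintype_card, add_comm]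

/-- Each nonzero vector is uniquely a scalar times one of the points, and `w` is invariant under
nonzero scalars. The sum over `E`, which is zero, is therefore `|F| - 1 = -1` times the sum over the
points. -/
lemma sum_points_eq_zero (hE : Module.finrank F E = 2) {η : E} (hη0 : η ≠ 0)
    (hη : orderOf η = Nat.card E - 1) (hgen : ∀ z : E, z ≠ 0 → ∃ m : ℕ, z = η ^ m) {N : ℕ}
    (hN : Fintype.card F = N) {w : E → F} (hw : w ∈ linForms F E ^ (N - 1)) :
    ∑ i : Fin (N + 1), w (η ^ (i : ℕ)) = 0 := by
  classical
  subst hN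
  have hF : 1 < Fintype.card F := Fintype.one_lt_card
  have := Fintype.ofFinite E
  have hhom : ∀ (a : Fˣ) z, w ((a : F) • z) = w z := fun a z => by
    rw [map_smul_of_mem_linForms_pow hw, FiniteField.pow_card_sub_one_eq_one _ a.ne_zero, one_mul]
  have hw0 : w 0 = 0 := by
    have := map_smul_of_mem_linForms_pow hw 0 0
    rwa [zero_smul, zero_pow (by omega), zero_mul] at this
  have hsum : ∑ p : Fˣ × Fin (Fintype.card F + 1), w (η ^ (p.2 : ℕ)) = ∑ z, w z := by
    refine Fintype.sum_of_injective (fun p : Fˣ × Fin (Fintype.card F + 1) =>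
      (p.1 : F) • η ^ (p.2 : ℕ)) ?_ _ _ ?_ fun p => (hhom _ _).symm
    · rintro ⟨a, i⟩ ⟨a', j⟩ h
      have hij : i = j := Fin.ext
        (eq_of_smul_pow_eq_smul_pow hE hη a.ne_zero a'.ne_zero i.2 j.2 h)
      subst hij
      have := smul_left_injective F (pow_ne_zero (i : ℕ) hη0) h
      exact Prod.ext (Units.ext this) rfl
    · intro z hz
      by_cases hz0 : z = 0
      · rw [hz0, hw0]
      · exfalso
        obtain ⟨m, rfl⟩ := hgen z hz0
        have hν : Algebra.norm F η ≠ 0 := by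
          rw [Algebra.norm_ne_zero_iff]; exact hη0
        -- Division of the exponent by `|F| + 1`, using that `η ^ (|F| + 1)` is the norm of `η`.
        refine hz ⟨(Units.mk0 _ hν ^ (m / (Fintype.card F + 1)),
          ⟨m % (Fintype.card F + 1), Nat.mod_lt _ (Nat.succ_pos _)⟩), ?_⟩
        simp only [Units.val_pow_eq_pow_val, Units.val_mk0, Algebra.smul_def, map_pow,
          algebraMap_norm_eq_pow_card_add_one hE, ← pow_mul, ← pow_add, Nat.div_add_mod]
  rw [sum_eq_zero_of_mem_linForms_pow hE hw, Fintype.sum_prod_type] at hsum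
  simp only at hsum
  rw [Finset.sum_const, Finset.card_univ, nsmul_eq_mul, mul_eq_zero] at hsum
  refine hsum.resolve_left ?_
  rw [Fintype.card_units, Nat.cast_sub hF.le, FiniteField.cast_card_eq_zero]
  simp

/-- Forms are stable under composition with multiplication by `η`, which moves each point to the
next and the last one to `norm η • 1`. Homogeneity and the Hermitian pairing turn that scalar into
`(norm η ^ m) ^ q`. -/
lemma isConstacyclic_hermitianDual_formCode (hE : Module.finrank F E = 2) {η : E} (hη0 : η ≠ 0)
    {N : ℕ} (hN : Fintype.card F = N) (m q : ℕ) :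
    IsConstacyclic (hermitianDual q (formCode F η N m)) := by
  have hν : Algebra.norm F η ≠ 0 := by
    rw [Algebra.norm_ne_zero_iff]; exact hη0
  refine ⟨(Algebra.norm F η ^ m) ^ q, pow_ne_zero _ (pow_ne_zero _ hν), fun v hv c hc => ?_⟩
  obtain ⟨f, hf, rfl⟩ := mem_formCode.1 hc
  have h1 := hv _ (mem_formCode.2 ⟨_, comp_mem_linForms_pow hf (LinearMap.mulLeft F η), rfl⟩)
  simp only [LinearMap.mulLeft_apply, ← pow_succ'] at h1
  rw [Fin.sum_univ_castSucc] at h1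
  have hlast : η ^ ((Fin.last N : ℕ) + 1) = Algebra.norm F η • (1 : E) := by
    rw [Algebra.smul_def, algebraMap_norm_eq_pow_card_add_one hE, hN, mul_one, Fin.val_last]
  rw [hlast, map_smul_of_mem_linForms_pow hf, mul_pow] at h1
  have hz : (0 : Fin (N + 1)) - 1 = Fin.last N := by
    apply Fin.ext; simp
  have hs : ∀ i : Fin N, i.succ - 1 = i.castSucc := fun i => by
    apply Fin.ext; simp [Fin.coe_sub_one]
  rw [Fin.sum_univ_succ]
  simp only [constaShift, hz, hs, Fin.succ_ne_zero, if_false, if_true, Fin.val_zero, pow_zero,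
    Fin.val_succ, Fin.val_castSucc] at h1 ⊢
  linear_combination h1

end ProjectivePoints

/-! ### Full-weight words of the puncture code -/

section Multipliers

variable {K F E : Type*} [Field K] [Fintype K] [Field F] [Algebra K F]
  [Field E] [Algebra F E]

variable {I : Type*} [Fintype I] {P : I → E}

/-- A `K`-valued function on `E` without nontrivial zeros which is orthogonal, on the points `P`,
to all products `f ^ q * g` of forms `f`, `g` of degree `m`. -/
def IsMultiplier (P : I → E) (m : ℕ) (h : E → K) : Prop :=
  (∀ z, z ≠ 0 → h z ≠ 0) ∧ ∀ f ∈ linForms F E ^ m, ∀ g ∈ linForms F E ^ m,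
    ∑ i, algebraMap K F (h (P i)) * (f (P i) ^ Fintype.card K * g (P i)) = 0

lemma isMultiplier_one
    (hP : ∀ w ∈ linForms F E ^ (Fintype.card K ^ 2 - 1), ∑ i, w (P i) = 0) :
    IsMultiplier (K := K) (F := F) P (Fintype.card K - 1) fun _ => 1 := by
  refine ⟨fun _ _ => one_ne_zero, fun f hf g hg => ?_⟩
  have h1 : (Fintype.card K - 1) * Fintype.card K + (Fintype.card K - 1) =
      Fintype.card K ^ 2 - 1 := by
    obtain ⟨r, hr⟩ := Nat.exists_eq_add_of_le (Fintype.card_pos (α := K))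
    rw [hr, eq_comm, Nat.sub_eq_iff_eq_add (Nat.one_le_pow _ _ (by omega)),
      Nat.add_sub_cancel_left]
    ring
  have h2 := hP _ (h1 ▸ mul_mem_linForms_pow (pow_mem_linForms_pow hf (Fintype.card K)) hg)
  simpa using h2

variable [Finite F]

lemma algebraMap_trace_eq_add_pow_card (hF : Module.finrank K F = 2) (z : F) :
    algebraMap K F (Algebra.trace K F z) = z + z ^ Fintype.card K := by
  rw [FiniteField.algebraMap_trace_eq_sum_pow, hF, Finset.sum_range_succ, Finset.sum_range_one,
    pow_zero, pow_one, pow_one, Nat.card_eq_fintype_card]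

/-- The multiplier is `u + v ^ q` with `u`, `v` of degree `q + 1`, the degree missing between `(q -
2) * (q + 1)` and `q ^ 2 - 1`. For `Y ≠ 0` and `t = X / Y` it equals `N(Y) * (Tr(t) ^ 2 - c)`,
nonzero because `c` is a nonsquare in `K`; for `Y = 0` it is `2 * N(X)`. -/
lemma exists_isMultiplier_of_odd (hF : Module.finrank K F = 2) (hE : Module.finrank F E = 2)
    (hodd : Odd (Fintype.card K))
    (hP : ∀ w ∈ linForms F E ^ (Fintype.card K ^ 2 - 1), ∑ i, w (P i) = 0) :
    ∃ h : E → K, IsMultiplier (F := F) P (Fintype.card K - 2) h := by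
  have : Module.Finite F E := Module.finite_of_finrank_pos (by omega)
  have := Fintype.ofFinite F
  have hq1 : 1 < Fintype.card K := Fintype.one_lt_card
  have hchar : ringChar K ≠ 2 := by
    rw [Nat.odd_iff] at hodd
    rw [Ne, FiniteField.even_card_iff_char_two]
    omega
  have h2 : (2 : K) ≠ 0 := Ring.two_ne_zero hchar
  obtain ⟨c, hc⟩ := FiniteField.exists_nonsquare hchar
  set q := Fintype.card K with hq
  let b := Module.finBasisOfFinrankEq F E hE
  let X : E → F := b.coord 0
  let Y : E → F := b.coord 1
  have hX : X ∈ linForms F E ^ 1 := (pow_one (linForms F E)).symm ▸ linearMap_mem_linForms _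
  have hY : Y ∈ linForms F E ^ 1 := (pow_one (linForms F E)).symm ▸ linearMap_mem_linForms _
  have hnorm : ∀ z : F, algebraMap K F (Algebra.norm K z) = z ^ (q + 1) :=
    fun z => algebraMap_norm_eq_pow_card_add_one hF z
  have htr : ∀ z : F, algebraMap K F (Algebra.trace K F z) = z + z ^ q :=
    fun z => algebraMap_trace_eq_add_pow_card hF z
  let v : E → F := X ^ 2 * Y ^ (q - 1)
  let u : E → F := (2 : F) • X ^ (q + 1) + v - algebraMap K F c • Y ^ (q + 1)
  have hv : v ∈ linForms F E ^ (q + 1) := by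
    have := mul_mem_linForms_pow (pow_mem_linForms_pow hX 2) (pow_mem_linForms_pow hY (q - 1))
    rwa [show 1 * 2 + 1 * (q - 1) = q + 1 by omega] at this
  have hu : u ∈ linForms F E ^ (q + 1) := by
    have hX' := pow_mem_linForms_pow hX (q + 1)
    have hY' := pow_mem_linForms_pow hY (q + 1)
    rw [one_mul] at hX' hY'
    exact sub_mem (add_mem (Submodule.smul_mem _ _ hX') hv) (Submodule.smul_mem _ _ hY')
  refine ⟨fun z => 2 * Algebra.norm K (X z) + Algebra.trace K F (X z ^ 2 * Y z ^ (q - 1)) -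
    c * Algebra.norm K (Y z), fun z hz => ?_, fun f hf g hg => ?_⟩
  · by_cases hYz : Y z = 0
    · have hXz : X z ≠ 0 := by
        intro hXz
        refine hz (b.repr.map_eq_zero_iff.1 (Finsupp.ext fun i => ?_))
        fin_cases i
        · exact hXz
        · exact hYz
      have : Algebra.norm K (X z) ≠ 0 := Algebra.norm_ne_zero_iff.2 hXz
      simp [hYz, zero_pow (show q - 1 ≠ 0 by omega), h2, this]
    · obtain ⟨t, ht⟩ : ∃ t, X z = t * Y z := ⟨X z / Y z, by field_simp⟩
      intro h0
      refine hc ⟨Algebra.trace K F t, ?_⟩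
      have hN : Algebra.norm K (Y z) ≠ 0 := Algebra.norm_ne_zero_iff.2 hYz
      refine mul_left_cancel₀ hN ((algebraMap K F).injective ?_)
      have h1 := congrArg (algebraMap K F) h0
      simp only [map_sub, map_add, map_mul, map_ofNat, map_zero, hnorm, htr, ht] at h1 ⊢
      have hpow : Y z ^ (q + 1) = Y z ^ 2 * Y z ^ (q - 1) := by
        rw [← pow_add]; congr 1; omega
      have hfix : (Y z ^ (q + 1)) ^ q = Y z ^ (q + 1) := by
        rw [pow_succ, mul_pow, pow_card_pow_card hF, mul_comm]
      have e1 : (t * Y z) ^ 2 * Y z ^ (q - 1) = t ^ 2 * Y z ^ (q + 1) := by rw [hpow]; ring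
      rw [e1, mul_pow _ (Y z ^ (q + 1)) q, hfix] at h1
      linear_combination (-1 : F) * h1
  · have hdeg : (q - 2) * q + (q - 2) + (q + 1) = q ^ 2 - 1 := by
      obtain ⟨r, hr⟩ := Nat.exists_eq_add_of_le (show 2 ≤ q from hq1)
      rw [hr, eq_comm, Nat.sub_eq_iff_eq_add (Nat.one_le_pow _ _ (by omega)),
        Nat.add_sub_cancel_left]
      ring
    have h1 := hP _ (hdeg ▸ mul_mem_linForms_pow
      (mul_mem_linForms_pow (pow_mem_linForms_pow hf q) hg) hu)
    -- The `v ^ q` part has too large a degree, but its sum is the `q`-th power of the sum of `g ^ q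
    -- * f * v`.
    have h3 := hP _ (hdeg ▸ mul_mem_linForms_pow
      (mul_mem_linForms_pow (pow_mem_linForms_pow hg q) hf) hv)
    have h4 := congrArg (· ^ q) h3
    simp only [hq, sum_pow_card, zero_pow Fintype.card_ne_zero] at h4
    simp only [← hq] at h4
    rw [← add_zero (0 : F)]
    nth_rw 1 [← h1]
    rw [← h4, ← Finset.sum_add_distrib]
    refine Finset.sum_congr rfl fun i _ => ?_
    have hg : (g (P i) ^ q) ^ q = g (P i) := pow_card_pow_card hF _
    simp only [← hq, map_sub, map_add, map_mul, map_ofNat, hnorm, htr, Pi.mul_apply, Pi.pow_apply,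
      mul_pow (_ * _) _ q, mul_pow (_ ^ q) _ q, hg, u, v, Pi.add_apply, Pi.sub_apply,
      Pi.smul_apply, smul_eq_mul]
    ring

/-- Multiplication by a power of the norm lowers the degree of a multiplier. -/
lemma IsMultiplier.norm_pow_mul (hF : Module.finrank K F = 2) (hE : Module.finrank F E = 2)
    {m j : ℕ} {h : E → K} (hh : IsMultiplier (F := F) P (m + 2 * j) h) :
    IsMultiplier (F := F) P m fun z => Algebra.norm K (Algebra.norm F z) ^ j * h z := by
  have : Module.Finite F E := Module.finite_of_finrank_pos (by omega)
  have : Module.Finite K F := Module.finite_of_finrank_pos (by omega)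
  have hN := pow_mem_linForms_pow (norm_mem_linForms_sq hE) j
  refine ⟨fun z hz => mul_ne_zero (pow_ne_zero _ ?_) (hh.1 z hz), fun f hf g hg => ?_⟩
  · exact Algebra.norm_ne_zero_iff.2 (Algebra.norm_ne_zero_iff.2 hz)
  -- The factor is `(ν ^ j) ^ q * ν ^ j` with `ν` the quadratic norm form from `E` to `F`, so one `ν
  -- ^ j` is absorbed into each of `f` and `g`.
  · rw [← hh.2 _ (mul_mem_linForms_pow hf hN) _ (mul_mem_linForms_pow hg hN)]
    refine Finset.sum_congr rfl fun i _ => ?_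
    simp only [map_mul, map_pow, algebraMap_norm_eq_pow_card_add_one hF, Pi.mul_apply,
      Pi.pow_apply]
    ring

/-- The parity of `q - 1 - m` decides whether to descend from degree `q - 1` or from `q - 2`; the
second start requires odd `q`. -/
lemma exists_isMultiplier (hF : Module.finrank K F = 2) (hE : Module.finrank F E = 2) {m : ℕ}
    (hm : m < Fintype.card K)
    (hpar : Odd (Fintype.card K) ∨ (Even (Fintype.card K) ∧ Odd m))
    (hP : ∀ w ∈ linForms F E ^ (Fintype.card K ^ 2 - 1), ∑ i, w (P i) = 0) :
    ∃ h : E → K, IsMultiplier (F := F) P m h := by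
  rcases Nat.even_or_odd' (Fintype.card K - 1 - m) with ⟨j, hj | hj⟩
  · have := isMultiplier_one (F := F) hP
    rw [show Fintype.card K - 1 = m + 2 * j by omega] at this
    exact ⟨_, this.norm_pow_mul hF hE⟩
  · have hodd : Odd (Fintype.card K) := by
      refine hpar.resolve_right fun ⟨h1, h2⟩ => ?_
      obtain ⟨r, hr⟩ := h1
      obtain ⟨s, hs⟩ := h2
      omega
    obtain ⟨h, hh⟩ := exists_isMultiplier_of_odd hF hE hodd hP
    rw [show Fintype.card K - 2 = m + 2 * j by omega] at hh
    exact ⟨_, hh.norm_pow_mul hF hE⟩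

end Multipliers

/-- An MDS code with a word of full weight in its puncture code yields a quantum MDS code. -/
lemma exists_quantumMDSCode_of_punctureCode {K F : Type*} [Field K] [Fintype K] [DecidableEq K]
    [Field F] [DecidableEq F] [Algebra K F] (e : F ≃ₗ[K] K × K) {χ : AddChar K ℂ} (hχ : χ ≠ 1)
    {n k : ℕ} {C : Submodule F (Fin n → F)} (hC : SeparatesCoordinates C k)
    (hCk : Module.finrank F C ≤ k) (hk : 2 * k < n) {x : Fin n → K} (hx0 : ∀ i, x i ≠ 0)
    (hx : ∀ c ∈ C, ∀ c' ∈ C,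
      ∑ i, algebraMap K F (x i) * (c i ^ Fintype.card K * c' i) = 0) :
    IsMDSCode (hermitianDual (Fintype.card K) C) (n - k) (k + 1) ∧
    ∃ x ∈ punctureCode K (Fintype.card K) C, hammingNorm x = n ∧
    ∃ y : Fin n → F, (∀ i, y i ^ (Fintype.card K + 1) = algebraMap K F (x i)) ∧
    rescale y C ≤ hermitianDual (Fintype.card K) (rescale y C) ∧
    ∃ Q : Submodule ℂ ((Fin n → K) → ℂ),
      IsStabilizerCodeOf χ e (rescale y C) Q ∧ IsQuantumMDSCode Q (n - 2 * k) (k + 1) := by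
  have hF := finrank_eq_two_of_linearEquiv e
  have : Module.Finite K F := Module.finite_of_finrank_pos (by omega)
  have : Finite F := Module.finite_of_finite K
  have hmds := hC.isMDSCode_hermitianDual (K := K) (by rw [Fintype.card_fin]; omega) hCk
  rw [Fintype.card_fin] at hmds
  choose y hy using fun i => FiniteField.norm_surjective K F (x i)
  have hyx : ∀ i, y i ^ (Fintype.card K + 1) = algebraMap K F (x i) := fun i => by
    rw [← hy i, algebraMap_norm_eq_pow_card_add_one hF]
  have hy0 : ∀ i, y i ≠ 0 := fun i h0 => hx0 i (by rw [← hy i, h0, Algebra.norm_zero])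
  have hself : rescale y C ≤ hermitianDual (Fintype.card K) (rescale y C) := by
    intro u hu v hv
    obtain ⟨c', hc', rfl⟩ := mem_rescale.1 hu
    obtain ⟨c, hc, rfl⟩ := mem_rescale.1 hv
    rw [← hx c hc c' hc']
    refine Finset.sum_congr rfl fun i _ => ?_
    rw [← hyx i]; ring
  refine ⟨hmds, x, ?_, ?_, y, hyx, hself, ?_⟩
  · intro s hs
    induction hs using Submodule.span_induction with
    | mem s hs =>
      obtain ⟨c, hc, c', hc', rfl⟩ := hs
      rw [← hx c hc c' hc']
      exact Finset.sum_congr rfl fun i _ => mul_comm _ _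
    | zero => simp
    | add s t _ _ h1 h2 => simp [add_mul, Finset.sum_add_distrib, h1, h2]
    | smul a s _ h1 => simp [mul_assoc, ← Finset.mul_sum, h1]
  · simp [hammingNorm, hx0]
  · have := (hC.rescale hy0).exists_isQuantumMDSCode hχ e
      ((finrank_rescale_le y C).trans hCk) (by rwa [Fintype.card_fin]) hself
    rwa [Fintype.card_fin] at this

theorem mainTheorem1 {K F : Type*} [Field K] [Fintype K] [DecidableEq K]
    [Field F] [DecidableEq F] [Algebra K F]
    (e : F ≃ₗ[K] K × K) (χ : AddChar K ℂ) (hχ : χ ≠ 1)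
    (q d : ℕ) (hq : Fintype.card K = q) (hd1 : 1 ≤ d) (hdq : d ≤ q + 1)
    (hpar : Odd q ∨ (Even q ∧ Odd d)) :
    ∃ C : Submodule F (Fin (q ^ 2 + 1) → F),
      IsConstacyclic (hermitianDual q C) ∧
      IsMDSCode (hermitianDual q C) (q ^ 2 + 2 - d) d ∧
      ∃ x ∈ punctureCode K q C, hammingNorm x = q ^ 2 + 1 ∧
      ∃ y : Fin (q ^ 2 + 1) → F, (∀ i, y i ^ (q + 1) = algebraMap K F (x i)) ∧
      rescale y C ≤ hermitianDual q (rescale y C) ∧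
      ∃ Q : Submodule ℂ ((Fin (q ^ 2 + 1) → K) → ℂ),
        IsStabilizerCodeOf χ e (rescale y C) Q ∧
        IsQuantumMDSCode Q (q ^ 2 + 3 - 2 * d) d := by
  have hF := finrank_eq_two_of_linearEquiv e
  have : Module.Finite K F := Module.finite_of_finrank_pos (by omega)
  have : Finite F := Module.finite_of_finite K
  have := Fintype.ofFinite F
  have hcard : Fintype.card F = q ^ 2 := by
    rw [← Nat.card_eq_fintype_card, natCard_of_finrank_eq_two hF, hq]
  have hq1 : 1 < q := hq ▸ Fintype.one_lt_card
  obtain ⟨k, rfl⟩ := Nat.exists_eq_add_of_le' hd1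
  have hkn : 2 * k < q ^ 2 + 1 := by
    have : k ≤ q := by omega
    obtain ⟨r, hr⟩ := Nat.exists_eq_add_of_lt hq1
    rw [hr] at this ⊢
    nlinarith
  rw [show q ^ 2 + 2 - (k + 1) = q ^ 2 + 1 - k by omega,
    show q ^ 2 + 3 - 2 * (k + 1) = q ^ 2 + 1 - 2 * k by omega]
  rcases k with _ | m
  -- For `d = 1` the zero code serves, and its dual is the whole space.
  · refine ⟨⊥, ⟨1, one_ne_zero, fun c _ c' hc' => by
      simp [(Submodule.mem_bot F).1 hc', zero_pow (show q ≠ 0 by omega)]⟩, ?_⟩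
    subst hq
    refine exists_quantumMDSCode_of_punctureCode e hχ (x := fun _ => 1) ?_ (by simp) hkn
      (fun _ => one_ne_zero) ?_
    · intro T hT i hi
      simp [Finset.card_eq_zero.1 hT] at hi
    · intro c hc c' hc'
      simp [(Submodule.mem_bot F).1 hc']
  · obtain ⟨p, hp⟩ := CharP.exists F
    have : Fact p.Prime := ⟨CharP.char_is_prime F p⟩
    let E := FiniteField.Extension F p 2
    have hE : Module.finrank F E = 2 := FiniteField.finrank_extension F p 2
    obtain ⟨η, hη0, hη, hgen⟩ := exists_generator_powers E
    refine ⟨formCode F η (q ^ 2) m, isConstacyclic_hermitianDual_formCode hE hη0 hcard m q, ?_⟩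
    subst hq
    obtain ⟨h, hh0, hh⟩ := exists_isMultiplier (m := m) hF hE (by omega)
      -- Here `d = m + 2`, so `m` is odd along with `d`.
      (hpar.imp_right fun h => ⟨h.1, by
        obtain ⟨r, hr⟩ := h.2
        exact ⟨r - 1, by omega⟩⟩)
      (fun w hw => sum_points_eq_zero hE hη0 hη hgen hcard hw)
    refine exists_quantumMDSCode_of_punctureCode e hχ
      (x := fun i : Fin (Fintype.card K ^ 2 + 1) => h (η ^ (i : ℕ)))
      (separatesCoordinates_formCode hE hη0 hη hcard m) (finrank_formCode_le hE η _ m) hkn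
      (fun i => hh0 _ (pow_ne_zero _ hη0)) ?_
    intro c hc c' hc'
    obtain ⟨f, hf, rfl⟩ := mem_formCode.1 hc
    obtain ⟨g, hg, rfl⟩ := mem_formCode.1 hc'
    exact hh f hf g hg
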